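/- Fix an integer $r\ge 1$. Let $(T_{\alpha,j,k})_{0\le\alpha\le r+1;\ j,k\in\mathbb Z}$ be any solution, in invertible commuting variables (nonzero elements of a field), of the $A_r$ $T$-system $$T_{\alpha,j,k+1}T_{\alpha,j,k-1}=T_{\alpha,j+1,k}T_{\alpha,j-1,k}+T_{\alpha+1,j,k}T_{\alpha-1,j,k}\quad(1\le\alpha\le r),\qquad T_{0,j,k}=T_{r+1,j,k}=1 .$$ Let $M=(m_1,\dots,m_r)\in\mathbb Z^r$ be a Motzkin path, i.e. $|m_i-m_{i+1}|\le 1$ for $1\le i<r$, with seed data $x_M=\{T_{\alpha,j,m_\alpha},T_{\alpha,j,m_\alpha+1}:1\le\alpha\le r,\ j\in\mathbb Z\}$. **The graph $\Gamma_M$.** For $1\le\alpha\le r$ let $a_\alpha=\#\{\beta: 1\le\beta<\alpha,\ m_{\beta+1}=m_\beta+1\}$ and $p_\alpha=\alpha+a_\alpha$. The spine vertices are $0,1,\dots,p_r+2$, and $0$ is the root. There are $2r+1$ skeleton edges, which may be traversed in both directions: edge $1$ joins $0$ and $1$; edge $2\alpha$ joins $p_\alpha$ and $p_\alpha+1$ ($1\le\alpha\le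 r$); for $1\le\alpha<r$, edge $2\alpha+1$ joins $p_\alpha+1$ to $p_\alpha+2$ if $m_{\alpha+1}=m_\alpha+1$, and joins $p_\alpha+1$ to an additional vertex $(p_\alpha+1)'$ otherwise; edge $2r+1$ joins $p_r+1$ and $p_r+2$. In addition, for all $1\le\alpha<\beta\le r$ with $m_{\gamma+1}=m_\gamma-1$ for every $\alpha\le\gamma<\beta$, there is one oriented (long) edge $p_\beta+1\to p_\alpha$. **Times and weights.** A step along a skeleton edge takes time $1$; the long step $p_\beta+1\to p_\alpha$ takes time $1-(\beta-\alpha)$. A step away from the root along a skeleton edge has weight $1$. A step towards the root along the skeleton edge $e$, starting at time $t$, has weight $y_e(t)$, where, with $\lambda_{\alpha,t,n}=T_{\alpha,t,n+1}/T_{\alpha,t+1,n}$ and $\mu_{\alpha,t,n}=T_{\alpha,t,n}/T_{\alpha-1,t+1,n}$, $$y_1(t)=\lambda_{1,t,m_1},\qquad y_{2\alpha-1}(t)=\frac{\lambda_{\alpha,\,s+m_\alpha-m_1-1,\,m_\alpha}}{\lambda_{\alpha-1,\,s+m_{\alpha-1}-m_1,\,m_{\alpha-1}}}\quad(2\le\alpha\le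 r+1,\ s=t-a_{\alpha-1}),$$ and, for $1\le\alpha\le r$ with $s=t-a_\alpha$, $$y_{2\alpha}(t)=\frac{\mu_{\alpha+1,\,s+m_\alpha-m_1,\,m_\alpha+1}}{\mu_{\alpha,\,s+m_\alpha-m_1,\,m_\alpha}}\cdot A\cdot B,$$ where $A=\dfrac{\lambda_{\alpha+1,\,s+m_{\alpha+1}-m_1,\,m_{\alpha+1}}}{\lambda_{\alpha+1,\,s+m_\alpha-m_1,\,m_\alpha}}$ if $m_\alpha=m_{\alpha+1}+1$ and $A=1$ otherwise, and $B=\dfrac{\lambda_{\alpha-1,\,s+m_\alpha-m_1,\,m_\alpha}}{\lambda_{\alpha-1,\,s+m_{\alpha-1}-m_1,\,m_{\alpha-1}}}$ if $m_\alpha=m_{\alpha-1}-1$ and $B=1$ otherwise (since $\lambda_{0,t,n}=\lambda_{r+1,t,n}=1$, the values given to $m_0,m_{r+1}$ are irrelevant). The long step $p_\beta+1\to p_\alpha$ starting at time $t$ has weight $$\Big(\prod_{i=0}^{\beta-\alpha-1}\frac{y_{2(\beta-i)}(t-i)}{y_{2(\beta-i)-1}(t-i)}\Big)\,y_{2\alpha}(t-\beta+\alpha).$$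 The weight of a path is the product of the weights of its successive steps, each taken at the time at which it starts. **Theorem.** For every Motzkin path $M$, every $j\in\mathbb Z$ and every integer $k\ge 0$, there are finitely many paths on $\Gamma_M$ that start at the root at time $j-k$ and end at the root at time $j+k$, and $$\frac{T_{1,j,k+m_1}}{T_{1,j+k,m_1}}$$ is the sum of the weights of these paths. Moreover, this ratio is a positive Laurent polynomial in the seed data $x_M$: there is a Laurent polynomial with nonnegative integer coefficients, depending only on $r,M,j,k$, whose value at $x_M$ is the ratio for every solution $T$. -/

import Mathlib

namespace TSystem

/-! ### The `A_r` T-system and Motzkin paths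

A family `T_{α,j,k}` is written `T α j k`; only `0 ≤ α ≤ r + 1` is relevant.  A Motzkin path
`(m_1, …, m_r)` is a function `m : ℕ → ℤ` of which only the values at `1, …, r` matter. -/

/-- `T` is a solution of the `A_r` T-system in the field `K`, in invertible variables, with
boundary values `T_{0,j,k} = T_{r+1,j,k} = 1`. -/
structure IsSolution (r : ℕ) {K : Type*} [Field K] (T : ℕ → ℤ → ℤ → K) : Prop where
  bot : ∀ j k : ℤ, T 0 j k = 1
  top : ∀ j k : ℤ, T (r + 1) j k = 1
  ne_zero : ∀ α : ℕ, 1 ≤ α → α ≤ r → ∀ j k : ℤ, T α j k ≠ 0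
  evolution : ∀ α : ℕ, 1 ≤ α → α ≤ r → ∀ j k : ℤ,
    T α j (k + 1) * T α j (k - 1) =
      T α (j + 1) k * T α (j - 1) k + T (α + 1) j k * T (α - 1) j k

/-- `(m_1, …, m_r)` is a Motzkin path: `|m_i - m_{i+1}| ≤ 1`. -/
def IsMotzkin (r : ℕ) (m : ℕ → ℤ) : Prop :=
  ∀ i : ℕ, 1 ≤ i → i < r → |m i - m (i + 1)| ≤ 1

/-- Index set of the seed `x_M`: the index `(α, j, i)` stands for `T_{α+1, j, m_{α+1}+i}`, where
`α` is counted from `0`. -/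
abbrev SeedIndex (r : ℕ) : Type := Fin r × ℤ × Fin 2

/-- The seed data `x_M = {T_{α,j,m_α+i} : 1 ≤ α ≤ r, j ∈ ℤ, i = 0, 1}`. -/
def seed (r : ℕ) (m : ℕ → ℤ) {K : Type*} (T : ℕ → ℤ → ℤ → K) : SeedIndex r → K :=
  fun s => T (s.1.val + 1) s.2.1 (m (s.1.val + 1) + (s.2.2.val : ℤ))

/-! ### Laurent polynomials with nonnegative integer coefficients -/

/-- Laurent polynomials in variables indexed by `σ` with nonnegative integer coefficients: the
value of `L` at an exponent vector is the coefficient of the corresponding monomial. -/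
abbrev PosLaurent (σ : Type*) : Type _ := (σ →₀ ℤ) →₀ ℕ

/-- The value of a positive Laurent polynomial at `x`. -/
noncomputable def PosLaurent.eval {σ K : Type*} [Field K] (L : PosLaurent σ) (x : σ → K) : K :=
  L.sum fun e c => (c : K) * e.prod fun s n => x s ^ n

/-! ### The rooted graph `Γ_M`

`Γ_M` is the gluing of the graphs of the maximal monotone pieces of the Motzkin path (consecutive
pieces share an end point) with one more edge added at the bottom and at the top.  Its skeleton
edges are labelled `1, …, 2r+1` from bottom to top: the edge `2α` belongs to the entry `m_α`, the
edge `2α+1` (for `1 ≤ α < r`) to the step from `m_α` to `m_{α+1}`, and `1`, `2r+1` are the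
additional ones.  All the edges `2α`, and the edges `1` and `2r+1`, are spine edges.  The edge
`2α+1` is a spine edge if the step is ascending (a simple chain); it is an edge `i - i'` otherwise.
On a strictly descending piece, there is in addition a long descending edge from the top of
the edge `2β` to the bottom of the edge `2α`, for all `α < β` in that piece. -/

/-- Vertices: `spine i` is the vertex `i`, and `off i` is the vertex `i'` attached to `i`. -/
inductive Vertex : Type
  | spine (i : ℕ) : Vertex
  | off (i : ℕ) : Vertex

/-- The number of ascending steps of the Motzkin path before its entry `α`. -/
def ascents (m : ℕ → ℤ) (α : ℕ) : ℕ :=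
  ((Finset.Ico 1 α).filter fun β => m (β + 1) = m β + 1).card

/-- The bottom vertex of the skeleton edge `2α`, as a label on the spine (its top vertex is the
next one). -/
def base (m : ℕ → ℤ) (α : ℕ) : ℕ := α + ascents m α

/-- The endpoint nearer to the root of the skeleton edge with label `e`, for `1 ≤ e ≤ 2r+1`. -/
def nearEnd (m : ℕ → ℤ) (e : ℕ) : Vertex :=
  if e = 1 then .spine 0
  else if e % 2 = 0 then .spine (base m (e / 2))
  else .spine (base m (e / 2) + 1)

/-- The endpoint farther from the root of the skeleton edge with label `e`, for
`1 ≤ e ≤ 2r+1`. -/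
def farEnd (r : ℕ) (m : ℕ → ℤ) (e : ℕ) : Vertex :=
  if e = 1 then .spine 1
  else if e % 2 = 0 then .spine (base m (e / 2) + 1)
  else if e / 2 = r ∨ m (e / 2 + 1) = m (e / 2) + 1 then .spine (base m (e / 2) + 2)
  else .off (base m (e / 2) + 1)

/-- Labels of oriented edges: a skeleton edge traversed away from the root or towards it, or
the long descending edge from the top of the edge `2β` to the bottom of the edge `2α`. -/
inductive Step : Type
  | up (e : ℕ) : Step
  | down (e : ℕ) : Step
  | long (β α : ℕ) : Step

/-- The oriented edges that belong to `Γ_M`. -/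
def Step.Valid (r : ℕ) (m : ℕ → ℤ) : Step → Prop
  | .up e => 1 ≤ e ∧ e ≤ 2 * r + 1
  | .down e => 1 ≤ e ∧ e ≤ 2 * r + 1
  | .long β α => 1 ≤ α ∧ α < β ∧ β ≤ r ∧ ∀ γ, α ≤ γ → γ < β → m (γ + 1) = m γ - 1

/-- The origin of an oriented edge. -/
def Step.source (r : ℕ) (m : ℕ → ℤ) : Step → Vertex
  | .up e => nearEnd m e
  | .down e => farEnd r m e
  | .long β _ => .spine (base m β + 1)

/-- The end of an oriented edge. -/
def Step.target (r : ℕ) (m : ℕ → ℤ) : Step → Vertex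
  | .up e => farEnd r m e
  | .down e => nearEnd m e
  | .long _ α => .spine (base m α)

/-- The time taken by a step: `1` for a skeleton step, and `-(h - 2)` for a long step
`i → i - h`; here `h = β - α + 1`, so that this is `1 - (β - α)`. -/
def Step.duration : Step → ℤ
  | .up _ => 1
  | .down _ => 1
  | .long β α => 1 - ((β : ℤ) - (α : ℤ))

/-! ### The weights -/

section Weights

variable {K : Type*} [Field K]

/-- `λ_{α,t,n} = T_{α,t,n+1} / T_{α,t+1,n}`. -/
def lam (T : ℕ → ℤ → ℤ → K) (α : ℕ) (t n : ℤ) : K := T α t (n + 1) / T α (t + 1) n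

/-- `μ_{α,t,n} = T_{α,t,n} / T_{α-1,t+1,n}`, for `α ≥ 1`. -/
def mu (T : ℕ → ℤ → ℤ → K) (α : ℕ) (t n : ℤ) : K := T α t n / T (α - 1) (t + 1) n

/-- The weight `y_{2α-1}(M;t)`, for `1 ≤ α ≤ r+1`. The values of `m` at `0` and `r+1` play no
role, since `λ_{0,t,n} = λ_{r+1,t,n} = 1`. -/
def oddWeight (m : ℕ → ℤ) (T : ℕ → ℤ → ℤ → K) (α : ℕ) (t : ℤ) : K :=
  if α = 1 then lam T 1 t (m 1)
  else
    lam T α (t - ascents m (α - 1) + m α - m 1 - 1) (m α) /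
      lam T (α - 1) (t - ascents m (α - 1) + m (α - 1) - m 1) (m (α - 1))

/-- The weight `y_{2α}(M;t)`, for `1 ≤ α ≤ r`. The values of `m` at `0` and `r+1` play no
role, since `λ_{0,t,n} = λ_{r+1,t,n} = 1`. -/
def evenWeight (m : ℕ → ℤ) (T : ℕ → ℤ → ℤ → K) (α : ℕ) (t : ℤ) : K :=
  mu T (α + 1) (t - ascents m α + m α - m 1) (m α + 1) /
      mu T α (t - ascents m α + m α - m 1) (m α) *
    (if m α = m (α + 1) + 1 then
      lam T (α + 1) (t - ascents m α + m (α + 1) - m 1) (m (α + 1)) /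
        lam T (α + 1) (t - ascents m α + m α - m 1) (m α)
      else 1) *
    (if m α = m (α - 1) - 1 then
      lam T (α - 1) (t - ascents m α + m α - m 1) (m α) /
        lam T (α - 1) (t - ascents m α + m (α - 1) - m 1) (m (α - 1))
      else 1)

/-- The skeleton weight `y_e(M;t)`, for `1 ≤ e ≤ 2r+1`. -/
def skeletonWeight (m : ℕ → ℤ) (T : ℕ → ℤ → ℤ → K) (e : ℕ) (t : ℤ) : K :=
  if e % 2 = 0 then evenWeight m T (e / 2) t else oddWeight m T ((e + 1) / 2) t

/-- The weight of a step taken at time `t`. With `⟨t|d = ⟨t+1|` and `⟨t|Y_e = y_e(t)⟨t+1|`, the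
operator attached to a step is `d` away from the root, `Y_e` towards the root along the skeleton
edge `e`, and the ordered product
`(Y_{2β} (d Y_{2β-1})⁻¹) ⋯ (Y_{2α+2} (d Y_{2α+1})⁻¹) Y_{2α}` on a long edge; each factor
`Y_{2γ} (d Y_{2γ-1})⁻¹` sends `⟨t|` to `(y_{2γ}(t) / y_{2γ-1}(t)) ⟨t-1|`. -/
def Step.weight (m : ℕ → ℤ) (T : ℕ → ℤ → ℤ → K) : Step → ℤ → K
  | .up _, _ => 1
  | .down e, t => skeletonWeight m T e t
  | .long β α, t =>
      (∏ i ∈ Finset.range (β - α),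
        skeletonWeight m T (2 * (β - i)) (t - (i : ℤ)) /
          skeletonWeight m T (2 * (β - i) - 1) (t - (i : ℤ))) *
      skeletonWeight m T (2 * α) (t - ((β : ℤ) - (α : ℤ)))

/-- The weight of a path that starts at time `t`: the product of the weights of its steps, each
at the time at which it is taken. -/
def pathWeight (m : ℕ → ℤ) (T : ℕ → ℤ → ℤ → K) : List Step → ℤ → K
  | [], _ => 1
  | e :: p, t => e.weight m T t * pathWeight m T p (t + e.duration)

end Weights

/-! ### Paths and their partition function -/

/-- `p` is a path on `Γ_M` that leads from the vertex `u` at time `t` to the vertex `v` at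
time `t'`. -/
def IsPath (r : ℕ) (m : ℕ → ℤ) (v : Vertex) (t' : ℤ) : List Step → Vertex → ℤ → Prop
  | [], u, t => u = v ∧ t = t'
  | e :: p, u, t =>
      e.Valid r m ∧ e.source r m = u ∧ IsPath r m v t' p (e.target r m) (t + e.duration)

/-- The paths on `Γ_M` from the root at time `t` to the root at time `t'`. -/
def rootPaths (r : ℕ) (m : ℕ → ℤ) (t t' : ℤ) : Set (List Step) :=
  {p | IsPath r m (.spine 0) t' p (.spine 0) t}

/-- The partition function for paths on `Γ_M` from the root at time `t` to the root at time
`t'`. -/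
noncomputable def partitionFunction {K : Type*} [Field K] (r : ℕ) (m : ℕ → ℤ)
    (T : ℕ → ℤ → ℤ → K) (t t' : ℤ) : K :=
  ∑ᶠ p ∈ rootPaths r m t t', pathWeight m T p t

end TSystem

/-! The T-system is the compatibility condition of two linear equations. Their solutions (`wave`)
are determined by bottom values that depend only on `j - k`; one should think of minors of the
bottom variables with one free column. If the free column is the line `j + k = x` of `T 1`, the wave
has a window of `β` consecutive zeros on level `β`, because the free column repeats another one,
followed by the value `T (β + 1)` (`wave_boundary`). On level `r + 1` it vanishes at every site of
the relevant parity (`wave_top_eq_zero`).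

On the graph, height minus time is unchanged by a step up and drops by 2 at every descending step,
long ones included. So a vertex together with the number `n` of descending steps left determines the
time. Splitting paths by their first step, and eliminating all vertices except the root and the tops
of the edges `2β`, gives `ReducedSystem`. It is triangular, hence has at most one solution
(`ReducedSystem.unique`).

Both sides of the formula solve it. The path sums do so by construction of the graph
(`reducedSystem_pathValue`). The wave at the seed sites, normalized and cut off, does so because the
weights `y_e` are the coefficients of the linear equations (`reducedSystem_seedValue`). The cut lies
in the window of zeros and is invisible to the recursion, except at the root: there the window is
empty and the cut produces the source term `1`. The value at the root for `n = k` is the required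
ratio.

For positivity, there are finitely many paths and each weight is a Laurent monomial in the seed
(`pathWeight_mem`), the factors `A` and `B` removing the variables that lie outside it. -/

namespace TSystem

/-! ### The linear problem of the T-system. -/

section Wave

variable {K : Type*} [Field K]

/-- The solution of the linear problem of the T-system with bottom values `f`. For
`T_{α,j,k}` a discrete Wronskian of `T_1`, it is a minor with one free column. -/
def wave (T : ℕ → ℤ → ℤ → K) (f : ℤ → K) : ℕ → ℤ → ℤ → K
  | 0, j, k => f (j - k)
  | α + 1, j, k =>
      (T (α + 1) j k * wave T f α (j - 1) k - T (α + 1) (j - 1) (k + 1) * wave T f α j (k - 1)) /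
        T α (j - 1) k

variable {r : ℕ} {T : ℕ → ℤ → ℤ → K}

theorem IsSolution.ne_zero' (hT : IsSolution r T) {α : ℕ} (hα : α ≤ r + 1) (j k : ℤ) :
    T α j k ≠ 0 := by
  rcases Nat.eq_zero_or_pos α with rfl | h
  · simp [hT.bot]
  · rcases Nat.lt_or_ge r α with h' | h'
    · obtain rfl : α = r + 1 := by omega
      simp [hT.top]
    · exact hT.ne_zero α h h' j k

theorem wave_zero_shift (f : ℤ → K) (j k : ℤ) : wave T f 0 (j + 1) (k + 1) = wave T f 0 j k := by
  simp only [wave]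
  congr 1
  ring

theorem wave_succ (hT : IsSolution r T) (f : ℤ → K) {β : ℕ} (hβ : β ≤ r) (j k : ℤ) :
    wave T f (β + 1) j k * T β (j - 1) k =
      T (β + 1) j k * wave T f β (j - 1) k - T (β + 1) (j - 1) (k + 1) * wave T f β j (k - 1) := by
  rw [wave, div_mul_cancel₀ _ (hT.ne_zero' (by omega) _ _)]

/-- The relation between waves on one level. -/
def LevelRelation (T : ℕ → ℤ → ℤ → K) (f : ℤ → K) (β : ℕ) : Prop :=
  ∀ j k : ℤ,
    T (β + 1) j k * (wave T f β (j - 1) k * T β j (k + 1) - wave T f β j (k + 1) * T β (j - 1) k) =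
      T (β + 1) (j - 1) (k + 1) *
        (wave T f β j (k - 1) * T β j (k + 1) - wave T f β (j + 1) k * T β (j - 1) k)

theorem levelRelation_zero (f : ℤ → K) (hT : IsSolution r T) : LevelRelation T f 0 := by
  intro j k
  have h1 := wave_zero_shift (T := T) f (j - 1) k
  have h2 := wave_zero_shift (T := T) f j (k - 1)
  simp only [sub_add_cancel] at h1 h2
  simp only [hT.bot]
  rw [h1, h2]
  ring

/-- The second linear equation. The level relation says exactly that it agrees with the one that
defines the wave on level `β + 1`. -/
theorem wave_succ_right_of_level (hT : IsSolution r T) {f : ℤ → K} {β : ℕ} (hβ : β ≤ r)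
    (h : LevelRelation T f β) (j k : ℤ) :
    wave T f (β + 1) j k * T β j (k + 1) =
      T (β + 1) j k * wave T f β j (k + 1) - T (β + 1) (j - 1) (k + 1) * wave T f β (j + 1) k := by
  have h3 := wave_succ hT f hβ j k
  have h4 := h j k
  apply mul_right_cancel₀ (hT.ne_zero' (α := β) (by omega) (j - 1) k)
  linear_combination (T β j (k + 1)) * h3 + h4

/-- Cramer's rule. The two linear equations, at `(j, k)` and `(j + 1, k + 1)`, have the same two
unknowns on level `β`, and by the T-system their determinant is `T (β + 2) j (k + 1) * T β j (k +
1)` up to sign. This lemma solves for one unknown, `wave_one_of_level` for the other. -/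
theorem wave_two_of_level (hT : IsSolution r T) {f : ℤ → K} {β : ℕ} (hβ : β + 1 ≤ r)
    (h : LevelRelation T f β) (j k : ℤ) :
    T (β + 2) j (k + 1) * wave T f β (j + 1) k =
      wave T f (β + 1) j k * T (β + 1) (j + 1) (k + 1) -
        wave T f (β + 1) (j + 1) (k + 1) * T (β + 1) j k := by
  have h4 := wave_succ_right_of_level hT (by omega) h j k
  have h3 := wave_succ hT f (β := β) (by omega) (j + 1) (k + 1)
  have ev := hT.evolution (β + 1) (by omega) hβ j (k + 1)
  simp only [add_sub_cancel_right, Nat.add_sub_cancel, add_assoc, Int.reduceAdd,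
    Nat.reduceAdd] at h3 h4 ev ⊢
  apply mul_right_cancel₀ (hT.ne_zero' (α := β) (by omega) j (k + 1))
  linear_combination (-T (β + 1) (j + 1) (k + 1)) * h4 + (T (β + 1) j k) * h3
    - wave T f β (j + 1) k * ev

theorem wave_one_of_level (hT : IsSolution r T) {f : ℤ → K} {β : ℕ} (hβ : β + 1 ≤ r)
    (h : LevelRelation T f β) (j k : ℤ) :
    T (β + 2) j (k + 1) * wave T f β j (k + 1) =
      wave T f (β + 1) j k * T (β + 1) j (k + 2) -
        wave T f (β + 1) (j + 1) (k + 1) * T (β + 1) (j - 1) (k + 1) := by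
  have h4 := wave_succ_right_of_level hT (by omega) h j k
  have h3 := wave_succ hT f (β := β) (by omega) (j + 1) (k + 1)
  have ev := hT.evolution (β + 1) (by omega) hβ j (k + 1)
  simp only [add_sub_cancel_right, Nat.add_sub_cancel, add_assoc, Int.reduceAdd,
    Nat.reduceAdd] at h3 h4 ev ⊢
  apply mul_right_cancel₀ (hT.ne_zero' (α := β) (by omega) j (k + 1))
  linear_combination (-T (β + 1) j (k + 2)) * h4 + (T (β + 1) (j - 1) (k + 1)) * h3
    - wave T f β j (k + 1) * ev

/-- Compatibility propagates upwards: both Cramer formulas, suitably shifted, express the same wave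
on level `β`, and eliminating it leaves the relation on level `β + 1`. -/
theorem levelRelation (hT : IsSolution r T) (f : ℤ → K) {β : ℕ} (hβ : β ≤ r) :
    LevelRelation T f β := by
  induction β with
  | zero => exact levelRelation_zero f hT
  | succ β ih =>
    intro j k
    have h2 := wave_two_of_level hT hβ (ih (by omega)) (j - 1) k
    have h1 := wave_one_of_level hT hβ (ih (by omega)) j (k - 1)
    rw [show k - 1 + 2 = k + 1 by ring] at h1
    simp only [sub_add_cancel] at h1 h2
    linear_combination T (β + 2) (j - 1) (k + 1) * h1 - T (β + 2) j k * h2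

theorem wave_succ_right (hT : IsSolution r T) (f : ℤ → K) {β : ℕ} (hβ : β ≤ r) (j k : ℤ) :
    wave T f (β + 1) j k * T β j (k + 1) =
      T (β + 1) j k * wave T f β j (k + 1) - T (β + 1) (j - 1) (k + 1) * wave T f β (j + 1) k :=
  wave_succ_right_of_level hT hβ (levelRelation hT f hβ) j k

/-- On level `r + 1` the coefficients `T (r + 1)` are `1`, so the second equation at `(j, k)` and
the first at `(j + 1, k + 1)` have the same right-hand side. -/
theorem wave_top_shift (hT : IsSolution r T) (f : ℤ → K) (j k : ℤ) :
    wave T f (r + 1) (j + 1) (k + 1) = wave T f (r + 1) j k := by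
  have h4 := wave_succ_right hT f le_rfl j k
  have h3 := wave_succ hT f le_rfl (j + 1) (k + 1)
  simp only [add_sub_cancel_right, hT.top] at h3 h4
  apply mul_right_cancel₀ (hT.ne_zero' (α := r) (by omega) j (k + 1))
  rw [h3, h4]

/-- Bottom values of the wave with free column `x`: the bottom variables `T_{1,j,k}` with
`j + k = x`. -/
def bottomRow (T : ℕ → ℤ → ℤ → K) (x : ℤ) (c : ℤ) : K := T 1 ((c - 1 + x) / 2) ((x - c + 1) / 2)

/-- The free column coincides with a fixed one in the first part, and extends the fixed ones to a
minor of size `β + 1` in the second. The parity of the sites makes the divisions in `bottomRow`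
exact. -/
theorem wave_boundary (hT : IsSolution r T) (x : ℤ) {β : ℕ} (hβ : β ≤ r) :
    (∀ j k : ℤ, ∀ i : ℕ, i < β → x = j + k - β + 1 + 2 * i →
      wave T (bottomRow T x) β j k = 0) ∧
    (∀ j k : ℤ, x = j + k + β + 1 → wave T (bottomRow T x) β j k = T (β + 1) j (k + 1)) := by
  induction β with
  | zero =>
    refine ⟨fun j k i hi => by omega, fun j k hx => ?_⟩
    simp only [wave, bottomRow, Nat.cast_zero, zero_add] at hx ⊢
    congr 1 <;> omega
  | succ β ih =>
    obtain ⟨ih0, ih1⟩ := ih (by omega)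
    have hzero : ∀ j k : ℤ, ∀ i : ℕ, i < β + 1 → x = j + k - (β + 1 : ℕ) + 1 + 2 * i →
        wave T (bottomRow T x) (β + 1) j k = 0 := by
      intro j k i hi hx
      push_cast at hx
      have h3 := wave_succ hT (bottomRow T x) (β := β) (by omega) j k
      apply mul_right_cancel₀ (hT.ne_zero' (α := β) (by omega) (j - 1) k)
      rcases Nat.lt_or_ge i β with h | h
      · rw [h3, ih0 (j - 1) k i h (by omega), ih0 j (k - 1) i h (by omega)]
        ring
      -- The new zero: both terms of the linear equation are the same product of two values `T (β +
      -- 1)`.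
      · obtain rfl : i = β := by omega
        rw [h3, ih1 (j - 1) k (by omega), ih1 j (k - 1) (by omega), sub_add_cancel]
        ring
    refine ⟨hzero, fun j k hx => ?_⟩
    push_cast at hx
    have h1 := wave_one_of_level hT hβ (levelRelation hT (bottomRow T x) (β := β) (by omega)) j k
    rw [ih1 j (k + 1) (by omega), hzero (j + 1) (k + 1) β (by omega) (by push_cast; omega)] at h1
    apply mul_right_cancel₀ (hT.ne_zero' (α := β + 1) (by omega) j (k + 2))
    rw [show k + 1 + 1 = k + 2 by ring] at h1
    linear_combination -h1

theorem wave_top_eq_zero (hT : IsSolution r T) (x j k i : ℤ) (hx : x = j + k - r + 2 * i) :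
    wave T (bottomRow T x) (r + 1) j k = 0 := by
  have base : ∀ j k : ℤ, x = j + k + r → wave T (bottomRow T x) (r + 1) j k = 0 := by
    intro j k hx
    have h3 := wave_succ hT (bottomRow T x) le_rfl j k
    have hb := (wave_boundary hT x le_rfl).2
    rw [hb (j - 1) k (by omega), hb j (k - 1) (by omega)] at h3
    apply mul_right_cancel₀ (hT.ne_zero' (α := r) (by omega) (j - 1) k)
    rw [h3, sub_add_cancel]
    ring
  have shift : ∀ n : ℤ, wave T (bottomRow T x) (r + 1) (j + n) (k + n) =
      wave T (bottomRow T x) (r + 1) j k := by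
    intro n
    induction n using Int.induction_on with
    | zero => simp
    | succ n ih => rw [← ih, ← add_assoc, ← add_assoc, wave_top_shift hT]
    | pred n ih =>
      rw [← ih, ← wave_top_shift hT _ (j + (-n - 1)), show j + (-(n : ℤ) - 1) + 1 = j + -n by ring,
        show k + (-(n : ℤ) - 1) + 1 = k + -n by ring]
  rw [← shift (i - r), base]
  omega

/-- The wave, normalized so that steps away from the root have weight `1`. -/
def nwave (T : ℕ → ℤ → ℤ → K) (f : ℤ → K) (β : ℕ) (j k : ℤ) : K := wave T f β j k / T β j k

theorem IsSolution.lam_ne_zero (hT : IsSolution r T) {α : ℕ} (hα : α ≤ r + 1) (t n : ℤ) :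
    lam T α t n ≠ 0 :=
  div_ne_zero (hT.ne_zero' hα _ _) (hT.ne_zero' hα _ _)

theorem IsSolution.lam_zero (hT : IsSolution r T) (t n : ℤ) : lam T 0 t n = 1 := by
  simp [lam, hT.bot]

theorem IsSolution.lam_top (hT : IsSolution r T) (t n : ℤ) : lam T (r + 1) t n = 1 := by
  simp [lam, hT.top]

/-- This and the next three lemmas are the two linear equations and the two Cramer formulas, with
coefficients written as the quotients of `lam` and `mu` that occur in the weights. -/
theorem nwave_succ (hT : IsSolution r T) (f : ℤ → K) {β : ℕ} (hβ : β ≤ r) (j k : ℤ) :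
    nwave T f β (j + 1) k =
      lam T (β + 1) (j + 1) k / lam T β (j + 1) (k - 1) * nwave T f β (j + 2) (k - 1) +
        nwave T f (β + 1) (j + 2) k := by
  have h := wave_succ hT f hβ (j + 2) k
  rw [show j + 2 - 1 = j + 1 by ring] at h
  have n1 := hT.ne_zero' (α := β) (by omega) (j + 1) k
  have n2 := hT.ne_zero' (α := β) (by omega) (j + 2) (k - 1)
  have n3 := hT.ne_zero' (α := β + 1) (by omega) (j + 2) k
  simp only [nwave, lam, sub_add_cancel, add_assoc, Int.reduceAdd]
  field_simp
  linear_combination -h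

theorem nwave_succ_right (hT : IsSolution r T) (f : ℤ → K) {β : ℕ} (hβ : β ≤ r) (j k : ℤ) :
    nwave T f β j (k + 1) - nwave T f (β + 1) j k =
      lam T (β + 1) (j - 1) k / lam T β j k * nwave T f β (j + 1) k := by
  have h := wave_succ_right hT f hβ j k
  have n1 := hT.ne_zero' (α := β) (by omega) j (k + 1)
  have n2 := hT.ne_zero' (α := β) (by omega) (j + 1) k
  have n3 := hT.ne_zero' (α := β + 1) (by omega) j k
  simp only [nwave, lam, sub_add_cancel]
  field_simp
  linear_combination -h

theorem nwave_ascend (hT : IsSolution r T) (f : ℤ → K) {β : ℕ} (hβ : β + 1 ≤ r) (j k : ℤ) :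
    nwave T f (β + 1) j k =
      mu T (β + 2) j (k + 1) / mu T (β + 1) j k * nwave T f β (j + 1) k +
        nwave T f (β + 1) (j + 1) (k + 1) := by
  have h := wave_two_of_level hT hβ (levelRelation hT f (β := β) (by omega)) j k
  have n1 := hT.ne_zero' (α := β) (by omega) (j + 1) k
  have n2 := hT.ne_zero' (α := β + 1) (by omega) (j + 1) (k + 1)
  have n3 := hT.ne_zero' (α := β + 1) (by omega) j k
  simp only [nwave, mu, Nat.add_sub_cancel, show β + 2 - 1 = β + 1 from rfl]
  field_simp
  linear_combination -h

theorem nwave_level (hT : IsSolution r T) (f : ℤ → K) {β : ℕ} (hβ : β + 1 ≤ r) (j k : ℤ) :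
    nwave T f (β + 1) (j + 1) (k - 1) / lam T (β + 1) j (k - 1) =
      mu T (β + 2) j (k + 1) / mu T (β + 1) j k / lam T (β + 2) j k * nwave T f β (j + 1) k +
        nwave T f (β + 1) (j + 2) k / lam T (β + 1) (j + 1) k := by
  have h := wave_one_of_level hT hβ (levelRelation hT f (β := β) (by omega)) (j + 1) (k - 1)
  rw [show k - 1 + 2 = k + 1 by ring] at h
  simp only [sub_add_cancel, add_sub_cancel_right, add_assoc, Int.reduceAdd] at h
  have n1 := hT.ne_zero' (α := β) (by omega) (j + 1) k
  have n2 := hT.ne_zero' (α := β + 1) (by omega) (j + 1) (k + 1)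
  have n3 := hT.ne_zero' (α := β + 1) (by omega) j k
  have n4 := hT.ne_zero' (α := β + 1) (by omega) (j + 1) (k - 1)
  have n5 := hT.ne_zero' (α := β + 1) (by omega) (j + 2) k
  have n6 := hT.ne_zero' (α := β + 2) (by omega) (j + 1) k
  have n7 := hT.ne_zero' (α := β + 2) (by omega) j (k + 1)
  simp only [nwave, mu, lam, Nat.add_sub_cancel, show β + 2 - 1 = β + 1 from rfl, sub_add_cancel,
    add_assoc, Int.reduceAdd]
  field_simp
  linear_combination -h

end Wave

/-! ### The recursion for the partition functions, and its uniqueness. -/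

section Reduced

variable {K : Type*} [Field K]

/-- The time of a visit to the top of the skeleton edge `2β` with `n` descending steps left. -/
def tick (m : ℕ → ℤ) (t' : ℤ) (β : ℕ) (n : ℤ) : ℤ := t' + β + ascents m β + 1 - 2 * n

/-- The partition function at the bottom of the skeleton edge `2(β+1)`, in terms of those at the
tops of the skeleton edges. -/
def lowerValue (m : ℕ → ℤ) (y : ℕ → ℤ → K) (t' : ℤ) (b : ℕ → ℤ → K) (β : ℕ) (n : ℤ) : K :=
  if β = 0 ∨ m (β + 1) = m β + 1 then
    y (2 * β + 1) (tick m t' (β + 1) n - 1) * b β (n - 1) + b (β + 1) n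
  else b β n

/-- The contribution of the paths that start at the top of the skeleton edge `2β` with this edge
or with a long edge. -/
def descentSum (m : ℕ → ℤ) (y : ℕ → ℤ → K) (t' : ℤ) (b : ℕ → ℤ → K) : ℕ → ℤ → K
  | 0, _ => 0
  | β + 1, n =>
      y (2 * (β + 1)) (tick m t' (β + 1) n) * lowerValue m y t' b β (n - 1) +
        if 1 ≤ β ∧ m (β + 1) = m β - 1 then
          y (2 * (β + 1)) (tick m t' (β + 1) n) / y (2 * β + 1) (tick m t' (β + 1) n) *
            descentSum m y t' b β n
        else 0

/-- The recursion for the partition functions of the paths to the root, from the root (`β = 0`)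
and from the tops of the skeleton edges `2β`. -/
structure ReducedSystem (r : ℕ) (m : ℕ → ℤ) (y : ℕ → ℤ → K) (t' : ℤ) (b : ℕ → ℤ → K) : Prop where
  root : ∀ n, b 0 n = (if n = 0 then 1 else 0) + y 1 (t' + 1 - 2 * n) * b 0 (n - 1) + b 1 n
  spine : ∀ β, β + 1 ≤ r → ∀ n, b (β + 1) n = descentSum m y t' b (β + 1) n +
    y (2 * (β + 1) + 1) (tick m t' (β + 1) n + 1) * b (β + 1) (n - 1) +
      if β + 1 < r then b (β + 2) n else 0
  neg : ∀ β ≤ r, ∀ n < 0, b β n = 0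

/-- Every contribution begins with a descending step, so only values of `b` with fewer descents left
enter. -/
theorem descentSum_congr {r : ℕ} {m : ℕ → ℤ} {y : ℕ → ℤ → K} {t' : ℤ} {b b' : ℕ → ℤ → K} {n : ℤ}
    (h : ∀ β ≤ r, ∀ k < n, b β k = b' β k) {β : ℕ} (hβ : β ≤ r) :
    descentSum m y t' b β n = descentSum m y t' b' β n := by
  induction β with
  | zero => rfl
  | succ β ih =>
    simp only [descentSum, lowerValue]
    rw [ih (by omega), h β (by omega) (n - 1 - 1) (by omega), h β (by omega) (n - 1) (by omega),
      h (β + 1) hβ (n - 1) (by omega)]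

theorem ReducedSystem.unique {r : ℕ} (hr : 1 ≤ r) {m : ℕ → ℤ} {y : ℕ → ℤ → K} {t' : ℤ}
    {b b' : ℕ → ℤ → K} (h : ReducedSystem r m y t' b) (h' : ReducedSystem r m y t' b') (β : ℕ)
    (hβ : β ≤ r) (n : ℤ) : b β n = b' β n := by
  suffices H : ∀ N : ℕ, ∀ n : ℤ, n < N → ∀ β ≤ r, b β n = b' β n from
    H (n.toNat + 1) n (by omega) β hβ
  intro N
  induction N with
  | zero => intro n hn β hβ; rw [h.neg β hβ n (by simpa using hn), h'.neg β hβ n (by simpa using hn)]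
  | succ N ih =>
    intro n hn
    have low : ∀ β ≤ r, ∀ k < n, b β k = b' β k := fun β hβ k hk => ih k (by push_cast at hn; omega) β hβ
    -- For fixed `n` the only coupling is to the next higher edge, so the induction runs down from
    -- `β + 1 = r`.
    have top : ∀ i β, β + 1 + i = r → b (β + 1) n = b' (β + 1) n := by
      intro i
      induction i with
      | zero =>
        intro β hβ
        rw [h.spine β (by omega), h'.spine β (by omega), descentSum_congr low (by omega),
          low (β + 1) (by omega) _ (by omega), if_neg (by omega), if_neg (by omega)]
      | succ i ihi =>
        intro β hβ
        rw [h.spine β (by omega), h'.spine β (by omega), descentSum_congr low (by omega),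
          low (β + 1) (by omega) _ (by omega), ihi (β + 1) (by omega)]
    intro β hβ
    rcases β with _ | β
    · rw [h.root, h'.root, low 0 (by omega) _ (by omega), top (r - 1) 0 (by omega)]
    · exact top (r - (β + 1)) β (by omega)

end Reduced

/-! ### The wave at the seed sites solves the recursion. -/

section Solution

variable {K : Type*} [Field K] {r : ℕ} {m : ℕ → ℤ} {T : ℕ → ℤ → ℤ → K}

/-- The Motzkin path, extended by an ascending step at the bottom. -/
def extPath (m : ℕ → ℤ) (β : ℕ) : ℤ := if β = 0 then m 1 - 1 else m β

theorem extPath_succ (β : ℕ) : extPath m (β + 1) = m (β + 1) := rfl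

theorem IsMotzkin.extPath_step (hm : IsMotzkin r m) {β : ℕ} (hβ : β < r) :
    extPath m (β + 1) = extPath m β + 1 ∨ extPath m (β + 1) = extPath m β ∨
      extPath m (β + 1) = extPath m β - 1 := by
  rcases β with _ | β
  · left; simp [extPath]
  · have h := abs_le.1 (hm (β + 1) (by omega) hβ)
    simp only [extPath_succ]
    omega

theorem IsMotzkin.le_extPath (hm : IsMotzkin r m) {β : ℕ} (hβ : β ≤ r) :
    m 1 - 1 ≤ extPath m β + β := by
  induction β with
  | zero => simp [extPath]
  | succ β ih =>
    have h1 := ih (by omega)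
    have h2 := hm.extPath_step (β := β) (by omega)
    push_cast
    omega

/-- The normalized wave at the seed site that belongs to the top of the skeleton edge `2β`. -/
def seedWave (m : ℕ → ℤ) (T : ℕ → ℤ → ℤ → K) (t' : ℤ) (β : ℕ) (n : ℤ) : K :=
  nwave T (bottomRow T (t' + m 1)) β (t' + β + 1 - 2 * n + extPath m β - m 1) (extPath m β)

/-- The solution of the reduced system. -/
def seedValue (m : ℕ → ℤ) (T : ℕ → ℤ → ℤ → K) (t' : ℤ) (β : ℕ) (n : ℤ) : K :=
  if n < β + 1 + extPath m β - m 1 then 0 else seedWave m T t' β n / T 1 t' (m 1)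

/-- The window of zeros; the cut in `seedValue` is at its upper end. Hence `seedValue_of_le` holds
from the lower end on, which absorbs the differences between the cuts of neighbouring levels. -/
theorem seedWave_eq_zero (hT : IsSolution r T) (t' : ℤ) {β : ℕ} (hβ : β ≤ r) {n : ℤ}
    (h1 : 1 ≤ n + m 1 - extPath m β) (h2 : n + m 1 - extPath m β ≤ β) :
    seedWave m T t' β n = 0 := by
  rw [seedWave, nwave, (wave_boundary hT (t' + m 1) hβ).1 _ _ (n + m 1 - extPath m β - 1).toNat,
    zero_div]
  · omega
  · rw [Int.toNat_of_nonneg (by omega)]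
    ring

theorem seedValue_of_lt {t' : ℤ} {β : ℕ} {n : ℤ} (h : n < β + 1 + extPath m β - m 1) :
    seedValue m T t' β n = 0 :=
  if_pos h

theorem seedValue_of_le (hT : IsSolution r T) {t' : ℤ} {β : ℕ} (hβ : β ≤ r) {n : ℤ}
    (h : 1 + extPath m β - m 1 ≤ n) :
    seedValue m T t' β n = seedWave m T t' β n / T 1 t' (m 1) := by
  rw [seedValue]
  split_ifs with h'
  · rw [seedWave_eq_zero hT t' hβ (by omega) (by omega), zero_div]
  · rfl

/-- The factors of the weight `y_{2β}` that do not depend on `m_{β-1}`. -/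
def evenBase (m : ℕ → ℤ) (T : ℕ → ℤ → ℤ → K) (α : ℕ) (t : ℤ) : K :=
  mu T (α + 1) (t - ascents m α + m α - m 1) (m α + 1) /
      mu T α (t - ascents m α + m α - m 1) (m α) *
    (if m α = m (α + 1) + 1 then
      lam T (α + 1) (t - ascents m α + m (α + 1) - m 1) (m (α + 1)) /
        lam T (α + 1) (t - ascents m α + m α - m 1) (m α)
      else 1)

theorem skeletonWeight_one (t : ℤ) : skeletonWeight m T 1 t = lam T 1 t (m 1) := by
  simp [skeletonWeight, oddWeight]

theorem skeletonWeight_odd (β : ℕ) (t : ℤ) : skeletonWeight m T (2 * (β + 1) + 1) t =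
    lam T (β + 2) (t - ascents m (β + 1) + m (β + 2) - m 1 - 1) (m (β + 2)) /
      lam T (β + 1) (t - ascents m (β + 1) + m (β + 1) - m 1) (m (β + 1)) := by
  rw [skeletonWeight, if_neg (by omega), show (2 * (β + 1) + 1 + 1) / 2 = β + 2 by omega,
    oddWeight, if_neg (by omega), show β + 2 - 1 = β + 1 by omega]

theorem skeletonWeight_even (β : ℕ) (t : ℤ) : skeletonWeight m T (2 * (β + 1)) t =
    evenBase m T (β + 1) t *
    (if m (β + 1) = m β - 1 then
      lam T β (t - ascents m (β + 1) + m (β + 1) - m 1) (m (β + 1)) /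
        lam T β (t - ascents m (β + 1) + m β - m 1) (m β)
      else 1) := by
  rw [skeletonWeight, if_pos (by omega), show (2 * (β + 1)) / 2 = β + 1 by omega]
  rfl

theorem skeletonWeight_odd_ne_zero (hT : IsSolution r T) {β : ℕ} (hβ : β ≤ r) (t : ℤ) :
    skeletonWeight m T (2 * β + 1) t ≠ 0 := by
  rcases β with _ | β
  · rw [Nat.mul_zero, zero_add, skeletonWeight_one]
    exact hT.lam_ne_zero (by omega) _ _
  · rw [skeletonWeight_odd]
    exact div_ne_zero (hT.lam_ne_zero (by omega) _ _) (hT.lam_ne_zero (by omega) _ _)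

/-- The spine equation before the cut, with all descents collected in one wave on level `β` at the
row `m (β + 1)` of the level above. The factor `B` is absent from `evenBase` because it belongs to
the passage from this site to the seed row of level `β`. -/
theorem seedWave_expand (hT : IsSolution r T) (hm : IsMotzkin r m) (t' : ℤ) {β : ℕ}
    (hβ : β + 1 ≤ r) (n : ℤ) :
    seedWave m T t' (β + 1) n =
      evenBase m T (β + 1) (tick m t' (β + 1) n) *
        nwave T (bottomRow T (t' + m 1)) β (t' + β + 3 - 2 * n + m (β + 1) - m 1) (m (β + 1)) +
      skeletonWeight m T (2 * (β + 1) + 1) (tick m t' (β + 1) n + 1) *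
        seedWave m T t' (β + 1) (n - 1) +
      if β + 1 < r then seedWave m T t' (β + 2) n else 0 := by
  rw [skeletonWeight_odd]
  simp only [seedWave, evenBase, extPath_succ, tick]
  set f := bottomRow T (t' + m 1) with hf
  obtain ⟨j, hj⟩ : ∃ j, j = t' + (β + 1 : ℕ) + 1 - 2 * n + m (β + 1) - m 1 := ⟨_, rfl⟩
  obtain ⟨k, hk⟩ : ∃ k, k = m (β + 1) := ⟨_, rfl⟩
  have flat := nwave_succ hT f hβ (j - 1) k
  have level := nwave_level hT f hβ j k
  have l1 := hT.lam_ne_zero (α := β + 2) (by omega) j k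
  have l2 := hT.lam_ne_zero (α := β + 1) (by omega) j (k - 1)
  have l3 := hT.lam_ne_zero (α := β + 1) (by omega) (j + 1) k
  rw [show j - 1 + 1 = j by ring, show j - 1 + 2 = j + 1 by ring] at flat
  have e1 : t' + (β + 1 : ℕ) + ascents m (β + 1) + 1 - 2 * n - ascents m (β + 1) + m (β + 1) - m 1
      = j := by rw [hj]; ring
  have e2 : t' + (β + 1 : ℕ) + ascents m (β + 1) + 1 - 2 * n + 1 - ascents m (β + 1) + m (β + 1)
      - m 1 = j + 1 := by rw [hj]; ring
  have e3 : t' + β + 3 - 2 * n + m (β + 1) - m 1 = j + 1 := by rw [hj]; push_cast; ring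
  have e4 : t' + (β + 1 : ℕ) + 1 - 2 * (n - 1) + m (β + 1) - m 1 = j + 2 := by rw [hj]; ring
  have e5 : t' + (β + 1 : ℕ) + ascents m (β + 1) + 1 - 2 * n + 1 - ascents m (β + 1) + m (β + 2)
      - m 1 - 1 = j + (m (β + 2) - k) := by rw [hj, hk]; ring
  have e6 : t' + (β + 1 : ℕ) + ascents m (β + 1) + 1 - 2 * n - ascents m (β + 1)
      + m (β + 1 + 1) - m 1 = j + (m (β + 2) - k) := by rw [hj, hk]; ring
  have e7 : t' + (β + 2 : ℕ) + 1 - 2 * n + m (β + 2) - m 1 = j + 1 + (m (β + 2) - k) := by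
    rw [hj, hk]; push_cast; ring
  rw [e1, e2, e3, e4, e5, e6, e7, ← hj]
  simp only [Nat.add_assoc, Nat.reduceAdd, ← hk] at flat ⊢
  -- The case of a flat step; it also serves at the top level, where the last wave vanishes.
  have flat' : nwave T f (β + 1) j k = mu T (β + 2) j (k + 1) / mu T (β + 1) j k *
      nwave T f β (j + 1) k + lam T (β + 2) j k / lam T (β + 1) (j + 1) k *
        nwave T f (β + 1) (j + 2) k + nwave T f (β + 2) (j + 1) k := by
    rw [flat, div_mul_eq_mul_div, mul_div_assoc, level]
    field_simp
  by_cases h : β + 1 < r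
  · rw [if_pos h]
    have step := hm.extPath_step h
    simp only [extPath_succ, Nat.add_assoc, Nat.reduceAdd, ← hk] at step
    rcases step with s | s | s
    · rw [s, if_neg (by omega), show j + (k + 1 - k) = j + 1 by ring,
        show j + 1 + (k + 1 - k) = j + 2 by ring]
      have asc := nwave_ascend hT f hβ j k
      have succ := nwave_succ hT f (β := β + 1) (by omega) j (k + 1)
      rw [add_sub_cancel_right] at succ
      rw [asc, succ]
      ring
    · rw [s, if_neg (by omega), sub_self, add_zero, add_zero, mul_one]
      exact flat'
    · have right := nwave_succ_right hT f (β := β + 1) (by omega) j (k - 1)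
      rw [sub_add_cancel] at right
      rw [s, if_pos (by omega), show j + (k - 1 - k) = j - 1 by ring,
        show j + 1 + (k - 1 - k) = j by ring, sub_eq_iff_eq_add.1 right, div_mul_eq_mul_div,
        mul_div_assoc, level]
      field_simp
  · rw [if_neg h]
    obtain rfl : r = β + 1 := by omega
    have top : nwave T f (β + 2) (j + 1) k = 0 := by
      rw [nwave, hf, wave_top_eq_zero hT (t' + m 1) (j + 1) k (n + m 1 - k - 1), zero_div]
      rw [hj, hk]; push_cast; ring
    rw [flat', top]
    simp only [hT.lam_top]
    simp

theorem lowerValue_of_lt (hm : IsMotzkin r m) (y : ℕ → ℤ → K) {t' : ℤ} {β : ℕ} (hβ : β + 1 ≤ r)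
    {n : ℤ} (h : n < β + 2 + extPath m (β + 1) - m 1) :
    lowerValue m y t' (seedValue m T t') β (n - 1) = 0 := by
  have step := hm.extPath_step (β := β) hβ
  rw [lowerValue]
  split_ifs with hc
  · have : extPath m (β + 1) = extPath m β + 1 := by
      rcases hc with rfl | hc
      · simp [extPath]
      · rcases β with _ | β
        · simp [extPath]
        · exact hc
    rw [seedValue_of_lt (by omega), seedValue_of_lt (by push_cast; omega), mul_zero, add_zero]
  · have : extPath m (β + 1) ≠ extPath m β + 1 := by
      rcases β with _ | β
      · simp at hc
      · exact fun h => hc (Or.inr h)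
    exact seedValue_of_lt (by omega)

theorem descentSum_of_lt (hm : IsMotzkin r m) (y : ℕ → ℤ → K) {t' : ℤ} {β : ℕ} (hβ : β ≤ r)
    {n : ℤ} (h : n < β + 1 + extPath m β - m 1) :
    descentSum m y t' (seedValue m T t') β n = 0 := by
  induction β with
  | zero => rfl
  | succ β ih =>
    push_cast at h
    rw [descentSum, lowerValue_of_lt hm y hβ (by omega), mul_zero, zero_add]
    split_ifs with hc
    · obtain ⟨β, rfl⟩ : ∃ γ, β = γ + 1 := ⟨β - 1, by omega⟩
      simp only [extPath_succ] at h ih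
      rw [ih (by omega) (by push_cast; omega), mul_zero]
    · rfl

theorem ascents_succ (β : ℕ) :
    ascents m (β + 1) = ascents m β + if 1 ≤ β ∧ m (β + 1) = m β + 1 then 1 else 0 := by
  rcases β with _ | β
  · simp [ascents]
  · simp only [ascents]
    rw [← Finset.insert_Ico_right_eq_Ico_add_one (by omega), Finset.filter_insert]
    split_ifs with h1 h2 h2
    · rw [Finset.card_insert_of_notMem (by simp)]
    · exact absurd ⟨by omega, h1⟩ h2
    · exact absurd h2.2 h1
    · rfl

/-- After a flat step the site on the right is already the seed site of level `β`. After an ascent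
it is one row above, and `nwave_succ` splits it into the two ways of leaving a vertex of degree two.
-/
theorem lowerValue_of_le (hT : IsSolution r T) (hm : IsMotzkin r m) {t' : ℤ} {β : ℕ}
    (hβ : β + 1 ≤ r) {n : ℤ} (h : β + 2 + extPath m (β + 1) - m 1 ≤ n)
    (hd : extPath m (β + 1) ≠ extPath m β - 1) :
    lowerValue m (skeletonWeight m T) t' (seedValue m T t') β (n - 1) =
      nwave T (bottomRow T (t' + m 1)) β (t' + β + 3 - 2 * n + m (β + 1) - m 1) (m (β + 1)) /
        T 1 t' (m 1) := by
  have step := hm.extPath_step (β := β) hβ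
  have k0 : extPath m (β + 1) = m (β + 1) := rfl
  rw [lowerValue]
  split_ifs with hc
  · have ha : extPath m (β + 1) = extPath m β + 1 := by
      rcases hc with rfl | hc
      · simp [extPath]
      · rcases β with _ | β
        · simp [extPath]
        · exact hc
    rw [seedValue_of_le hT (by omega) (by omega),
      seedValue_of_le hT hβ (by omega), seedWave, seedWave, k0,
      show extPath m β = m (β + 1) - 1 by omega]
    have key := nwave_succ hT (bottomRow T (t' + m 1)) (β := β) (by omega)
      (t' + β + 2 - 2 * n + m (β + 1) - m 1) (m (β + 1))
    rw [show t' + (β : ℤ) + 3 - 2 * n + m (β + 1) - m 1 =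
      t' + β + 2 - 2 * n + m (β + 1) - m 1 + 1 by ring, key, add_div, ← mul_div_assoc]
    have hy : skeletonWeight m T (2 * β + 1) (tick m t' (β + 1) (n - 1) - 1) =
        lam T (β + 1) (t' + β + 2 - 2 * n + m (β + 1) - m 1 + 1) (m (β + 1)) /
          lam T β (t' + β + 2 - 2 * n + m (β + 1) - m 1 + 1) (m (β + 1) - 1) := by
      rcases β with _ | β
      · rw [Nat.mul_zero, zero_add, skeletonWeight_one, hT.lam_zero, div_one, tick,
          show ascents m 1 = 0 from rfl]
        congr 1
        push_cast
        ring
      · have hm1 : m (β + 2) = m (β + 1) + 1 := ha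
        rw [skeletonWeight_odd, tick, ascents_succ, if_pos ⟨by omega, ha⟩,
          show m (β + 1) = m (β + 2) - 1 by omega]
        congr 2 <;> push_cast <;> ring
    rw [hy]
    congr 4 <;> push_cast <;> ring
  · have hf : extPath m (β + 1) = extPath m β := by
      have : extPath m (β + 1) ≠ extPath m β + 1 := by
        rcases β with _ | β
        · simp at hc
        · exact fun h => hc (Or.inr h)
      omega
    rw [seedValue_of_le hT (by omega) (by omega), seedWave, ← hf, k0]
    congr 2
    ring

/-- Long edges telescope. On a descent, `seedWave_expand` one level below expresses the previous
descents as a difference. Dividing by the odd weight cancels its `n - 1` term against the short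
step, and `nwave_succ_right` turns what remains into a multiple of a single wave; `B` supplies the
missing factor. -/
theorem descentSum_of_le (hT : IsSolution r T) (hm : IsMotzkin r m) {t' : ℤ} {β : ℕ}
    (hβ : β + 1 ≤ r) {n : ℤ} (h : β + 2 + extPath m (β + 1) - m 1 ≤ n) :
    descentSum m (skeletonWeight m T) t' (seedValue m T t') (β + 1) n =
      evenBase m T (β + 1) (tick m t' (β + 1) n) *
        nwave T (bottomRow T (t' + m 1)) β (t' + β + 3 - 2 * n + m (β + 1) - m 1) (m (β + 1)) /
          T 1 t' (m 1) := by
  induction β with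
  | zero =>
    rw [descentSum, if_neg (by omega), add_zero, lowerValue_of_le hT hm hβ h
        (by have h1 : extPath m (0 + 1) = m 1 := rfl
            have h0 : extPath m 0 = m 1 - 1 := rfl
            omega),
      skeletonWeight_even, hT.lam_zero, hT.lam_zero]
    simp only [div_one, ite_self, mul_one]
    ring
  | succ β ih =>
    by_cases hd : m (β + 2) = m (β + 1) - 1
    · simp only [extPath_succ] at h ih
      push_cast at h
      have h' : (β : ℤ) + 1 + 2 + m (β + 2) - m 1 ≤ n := h
      have hd' : m (β + 1) = m (β + 2) + 1 := by omega
      have hd'' : m (β + 1) = m (β + 1 + 1) + 1 := hd'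
      have ha : ascents m (β + 2) = ascents m (β + 1) := by
        rw [ascents_succ, if_neg (by omega), add_zero]
      have ex := seedWave_expand hT hm t' (β := β) (by omega) n
      rw [if_pos (by omega)] at ex
      have ex' : evenBase m T (β + 1) (tick m t' (β + 1) n) * nwave T (bottomRow T (t' + m 1)) β
          (t' + β + 3 - 2 * n + m (β + 1) - m 1) (m (β + 1)) =
          seedWave m T t' (β + 1) n - skeletonWeight m T (2 * (β + 1) + 1)
            (tick m t' (β + 1) n + 1) * seedWave m T t' (β + 1) (n - 1) -
              seedWave m T t' (β + 2) n := by
        rw [ex]; ring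
      have ht : tick m t' (β + 2) n = tick m t' (β + 1) n + 1 := by
        rw [tick, tick, ha]; push_cast; ring
      have hy := skeletonWeight_odd_ne_zero (m := m) hT (β := β + 1) (by omega)
        (tick m t' (β + 1) n + 1)
      have low : lowerValue m (skeletonWeight m T) t' (seedValue m T t') (β + 1) (n - 1) =
          seedWave m T t' (β + 1) (n - 1) / T 1 t' (m 1) := by
        rw [lowerValue, if_neg (by omega), seedValue_of_le hT (by omega)]
        rw [extPath_succ]; omega
      have right := nwave_succ_right hT (bottomRow T (t' + m 1)) (β := β + 1) (by omega)
        (t' + β + 3 - 2 * n + m (β + 2) - m 1) (m (β + 2))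
      have s1 : seedWave m T t' (β + 1) n = nwave T (bottomRow T (t' + m 1)) (β + 1)
          (t' + β + 3 - 2 * n + m (β + 2) - m 1) (m (β + 2) + 1) := by
        rw [seedWave, extPath_succ, hd']; congr 1; push_cast; ring
      have s2 : seedWave m T t' (β + 2) n = nwave T (bottomRow T (t' + m 1)) (β + 2)
          (t' + β + 3 - 2 * n + m (β + 2) - m 1) (m (β + 2)) := by
        rw [seedWave, extPath_succ]; congr 1; push_cast; ring
      rw [← s1, ← s2] at right
      rw [descentSum, low, if_pos ⟨by omega, hd⟩, ih (by omega) (by omega), ex', ht,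
        skeletonWeight_even, if_pos hd]
      have hB : lam T (β + 1) (tick m t' (β + 1) n + 1 - ascents m (β + 2) + m (β + 2) - m 1)
            (m (β + 2)) / lam T (β + 1) (tick m t' (β + 1) n + 1 - ascents m (β + 2) + m (β + 1) - m 1)
              (m (β + 1)) * (seedWave m T t' (β + 1) n - seedWave m T t' (β + 2) n) =
          skeletonWeight m T (2 * (β + 1) + 1) (tick m t' (β + 1) n + 1) *
            nwave T (bottomRow T (t' + m 1)) (β + 1)
              (t' + (β + 1 : ℕ) + 3 - 2 * n + m (β + 2) - m 1) (m (β + 2)) := by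
        rw [right, skeletonWeight_odd, ha, tick]
        have e1 : t' + ((β + 1 : ℕ) : ℤ) + ascents m (β + 1) + 1 - 2 * n + 1 - ascents m (β + 1)
          + m (β + 2) - m 1 = t' + β + 3 - 2 * n + m (β + 2) - m 1 := by push_cast; ring
        have e2 : t' + ((β + 1 : ℕ) : ℤ) + 3 - 2 * n + m (β + 2) - m 1 =
          t' + β + 3 - 2 * n + m (β + 2) - m 1 + 1 := by push_cast; ring
        rw [e1, e2]
        have l1 := hT.lam_ne_zero (α := β + 1) (by omega)
          (t' + β + 3 - 2 * n + m (β + 2) - m 1) (m (β + 2))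
        field_simp
      set Y := skeletonWeight m T (2 * (β + 1) + 1) (tick m t' (β + 1) n + 1)
      field_simp
      simp only [Nat.add_assoc, Nat.reduceAdd]
      linear_combination evenBase m T (β + 2) (tick m t' (β + 1) n + 1) / T 1 t' (m 1) * hB
    · rw [descentSum, if_neg (fun h => hd h.2), add_zero, lowerValue_of_le hT hm hβ h hd,
        skeletonWeight_even, if_neg hd]
      ring

theorem reducedSystem_seedValue (hr : 1 ≤ r) (hT : IsSolution r T) (hm : IsMotzkin r m) (t' : ℤ) :
    ReducedSystem r m (skeletonWeight m T) t' (seedValue m T t') where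
  neg β hβ n hn := by
    have := hm.le_extPath hβ
    exact seedValue_of_lt (by omega)
  root n := by
    have k1 : extPath m 1 = m 1 := rfl
    have k0 : extPath m 0 = m 1 - 1 := rfl
    rcases lt_trichotomy n 0 with h | rfl | h
    · rw [seedValue_of_lt (by omega), seedValue_of_lt (by omega),
        seedValue_of_lt (by push_cast; omega), if_neg (by omega)]
      ring
    -- The source term: the wave at the root is `T 1 t' (m 1)`, the normalizing constant, while the
    -- other two values are cut off.
    · rw [seedValue_of_le hT (by omega) (by omega), seedValue_of_lt (n := 0 - 1) (by omega),
        seedValue_of_lt (β := 1) (by push_cast; omega), if_pos rfl, seedWave, nwave, wave,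
        bottomRow, hT.bot, k0, show (t' + ((0 : ℕ) : ℤ) + 1 - 2 * 0 + (m 1 - 1) - m 1 - (m 1 - 1) - 1
          + (t' + m 1)) / 2 = t' by push_cast; omega, show (t' + m 1 - (t' + ((0 : ℕ) : ℤ) + 1 - 2 * 0
          + (m 1 - 1) - m 1 - (m 1 - 1)) + 1) / 2 = m 1 by push_cast; omega, div_one,
        div_self (hT.ne_zero 1 le_rfl hr _ _)]
      ring
    · rw [seedValue_of_le hT (by omega) (by omega), seedValue_of_le hT (by omega) (by omega),
        seedValue_of_le hT (by omega) (by omega), if_neg (by omega), skeletonWeight_one]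
      have key := nwave_succ hT (bottomRow T (t' + m 1)) (β := 0) (by omega)
        (t' - 2 * n) (m 1)
      have shift := wave_zero_shift (T := T) (bottomRow T (t' + m 1)) (t' - 2 * n) (m 1 - 1)
      rw [sub_add_cancel] at shift
      have shift' : seedWave m T t' 0 n = nwave T (bottomRow T (t' + m 1)) 0
          (t' - 2 * n + 1) (m 1) := by
        rw [seedWave, nwave, nwave, hT.bot, hT.bot, shift, k0]
        congr 2
        push_cast
        ring
      rw [shift', key, hT.lam_zero, seedWave, seedWave, k0, k1, div_one, zero_add, zero_add,
        add_div, ← mul_div_assoc,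
        show t' + ((0 : ℕ) : ℤ) + 1 - 2 * (n - 1) + (m 1 - 1) - m 1 = t' - 2 * n + 2 by
          push_cast; ring,
        show t' + ((1 : ℕ) : ℤ) + 1 - 2 * n + m 1 - m 1 = t' - 2 * n + 2 by push_cast; ring,
        show t' + 1 - 2 * n = t' - 2 * n + 1 by ring]
  spine β hβ n := by
    rcases lt_or_ge n (β + 2 + extPath m (β + 1) - m 1) with h | h
    · rw [seedValue_of_lt (by push_cast; omega), seedValue_of_lt (n := n - 1) (by push_cast; omega),
        descentSum_of_lt hm _ hβ (by push_cast; omega)]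
      split_ifs with hr
      · have step := hm.extPath_step hr
        simp only [Nat.add_assoc, Nat.reduceAdd] at step
        rw [seedValue_of_lt (by push_cast; omega)]
        ring
      · ring
    · rw [seedValue_of_le hT hβ (by omega), seedValue_of_le hT hβ (by omega),
        descentSum_of_le hT hm hβ h, seedWave_expand hT hm t' hβ]
      split_ifs with hr
      · have step := hm.extPath_step hr
        simp only [Nat.add_assoc, Nat.reduceAdd] at step
        rw [seedValue_of_le hT (by omega) (by omega)]
        ring
      · ring

end Solution

/-! ### Incidences and heights in the graph; finiteness of the set of paths. -/

section Graph

variable {r : ℕ} {m : ℕ → ℤ}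

theorem base_succ_of_ascent {β : ℕ} (h : m (β + 2) = m (β + 1) + 1) :
    base m (β + 2) = base m (β + 1) + 2 := by
  rw [base, base, ascents_succ, if_pos ⟨by omega, h⟩]
  omega

/-- Without an ascent, the bottom of an even edge is the top of the preceding even edge; an ascent
inserts one odd spine edge between them. -/
theorem base_succ_of_not_ascent {β : ℕ} (h : m (β + 2) ≠ m (β + 1) + 1) :
    base m (β + 2) = base m (β + 1) + 1 := by
  rw [base, base, ascents_succ, if_neg (fun h' => h h'.2)]
  omega

theorem base_one : base m 1 = 1 := by
  simp [base, ascents]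

theorem base_add_le {α β : ℕ} (h : α ≤ β) : base m α + (β - α) ≤ base m β := by
  have : ascents m α ≤ ascents m β :=
    Finset.card_le_card (Finset.filter_subset_filter _ (Finset.Ico_subset_Ico_right h))
  simp only [base]
  omega

theorem ascents_eq_of_run {α β : ℕ} (h : α ≤ β) (hrun : ∀ γ, α ≤ γ → γ < β → m (γ + 1) = m γ - 1) :
    ascents m β = ascents m α := by
  induction β with
  | zero => rw [Nat.le_zero.1 h]
  | succ β ih =>
    rcases Nat.lt_or_ge β α with h' | h'
    · rw [show α = β + 1 by omega]
    · rw [ascents_succ, if_neg, add_zero, ih h' fun γ h1 h2 => hrun γ h1 (by omega)]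
      have := hrun β h' (by omega)
      omega

theorem nearEnd_one : nearEnd m 1 = .spine 0 := rfl

theorem nearEnd_even (γ : ℕ) : nearEnd m (2 * (γ + 1)) = .spine (base m (γ + 1)) := by
  rw [nearEnd, if_neg (by omega), if_pos (by omega), show 2 * (γ + 1) / 2 = γ + 1 by omega]

theorem nearEnd_odd (γ : ℕ) : nearEnd m (2 * (γ + 1) + 1) = .spine (base m (γ + 1) + 1) := by
  rw [nearEnd, if_neg (by omega), if_neg (by omega), show (2 * (γ + 1) + 1) / 2 = γ + 1 by omega]

theorem farEnd_one : farEnd r m 1 = .spine 1 := rfl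

theorem farEnd_even (γ : ℕ) : farEnd r m (2 * (γ + 1)) = .spine (base m (γ + 1) + 1) := by
  rw [farEnd, if_neg (by omega), if_pos (by omega), show 2 * (γ + 1) / 2 = γ + 1 by omega]

theorem farEnd_odd_of_spine {γ : ℕ} (h : γ + 1 = r ∨ m (γ + 2) = m (γ + 1) + 1) :
    farEnd r m (2 * (γ + 1) + 1) = .spine (base m (γ + 1) + 2) := by
  rw [farEnd, if_neg (by omega), if_neg (by omega), show (2 * (γ + 1) + 1) / 2 = γ + 1 by omega,
    if_pos h]

theorem farEnd_odd_of_off {γ : ℕ} (h : ¬ (γ + 1 = r ∨ m (γ + 2) = m (γ + 1) + 1)) :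
    farEnd r m (2 * (γ + 1) + 1) = .off (base m (γ + 1) + 1) := by
  rw [farEnd, if_neg (by omega), if_neg (by omega), show (2 * (γ + 1) + 1) / 2 = γ + 1 by omega,
    if_neg h]

theorem label_cases {e : ℕ} (h1 : 1 ≤ e) (h2 : e ≤ 2 * r + 1) :
    e = 1 ∨ ∃ γ, γ + 1 ≤ r ∧ (e = 2 * (γ + 1) ∨ e = 2 * (γ + 1) + 1) := by
  by_cases h : e = 1
  · exact Or.inl h
  · exact Or.inr ⟨e / 2 - 1, by omega, by omega⟩

/-- The distance of a vertex from the root, along the skeleton. -/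
def Vertex.height : Vertex → ℕ
  | .spine i => i
  | .off i => i + 1

theorem height_farEnd {e : ℕ} (h1 : 1 ≤ e) (h2 : e ≤ 2 * r + 1) :
    (farEnd r m e).height = (nearEnd m e).height + 1 := by
  rcases label_cases h1 h2 with rfl | ⟨γ, hγ, rfl | rfl⟩
  · rfl
  · rw [farEnd_even, nearEnd_even]; rfl
  · by_cases h : γ + 1 = r ∨ m (γ + 2) = m (γ + 1) + 1
    · rw [farEnd_odd_of_spine h, nearEnd_odd]; rfl
    · rw [farEnd_odd_of_off h, nearEnd_odd]; rfl

theorem height_nearEnd_lt {e : ℕ} (h1 : 1 ≤ e) (h2 : e ≤ 2 * r + 1) :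
    (nearEnd m e).height < base m r + 2 := by
  rcases label_cases h1 h2 with rfl | ⟨γ, hγ, rfl | rfl⟩
  · simp [nearEnd, Vertex.height]
  · have := base_add_le (m := m) hγ
    rw [nearEnd_even, Vertex.height]; omega
  · have := base_add_le (m := m) hγ
    rw [nearEnd_odd, Vertex.height]; omega

/-- The number of descending steps in a step. -/
def Step.drop : Step → ℤ
  | .up _ => 0
  | .down _ => 1
  | .long _ _ => 1

/-- The conservation law behind `tick`. On a long edge it uses that a descending run contains no
ascents, so that the height falls by `β - α + 1`. -/
theorem Step.Valid.height_target {e : Step} (he : e.Valid r m) :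
    ((e.target r m).height : ℤ) = (e.source r m).height + e.duration - 2 * e.drop := by
  rcases e with e | e | ⟨β, α⟩
  · simp only [target, source, duration, drop]
    rw [height_farEnd he.1 he.2]
    push_cast; ring
  · simp only [target, source, duration, drop]
    rw [height_farEnd he.1 he.2]
    push_cast; ring
  · simp only [target, source, duration, drop, Vertex.height, base]
    rw [ascents_eq_of_run he.2.1.le he.2.2.2]
    push_cast; ring

theorem Step.Valid.height_target_le {e : Step} (he : e.Valid r m) :
    (e.target r m).height ≤ base m r + 2 := by
  rcases e with e | e | ⟨β, α⟩
  · have := height_nearEnd_lt (m := m) he.1 he.2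
    rw [target, height_farEnd he.1 he.2]
    omega
  · exact (height_nearEnd_lt he.1 he.2).le
  · have := base_add_le (m := m) (he.2.1.le.trans he.2.2.1)
    simp only [target, Vertex.height]
    omega

/-- The oriented edges of `Γ_M` with origin `u`. -/
def outSteps (r : ℕ) (m : ℕ → ℤ) (u : Vertex) : Set Step := {e | e.Valid r m ∧ e.source r m = u}

theorem finite_valid (r : ℕ) (m : ℕ → ℤ) : {e : Step | e.Valid r m}.Finite := by
  refine (((Set.finite_Iic (2 * r + 1)).image Step.up).union
    (((Set.finite_Iic (2 * r + 1)).image Step.down).union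
      (((Set.finite_Iic r).prod (Set.finite_Iic r)).image fun p => Step.long p.1 p.2))).subset ?_
  rintro (e | e | ⟨β, α⟩) he
  · exact Or.inl ⟨e, he.2, rfl⟩
  · exact Or.inr (Or.inl ⟨e, he.2, rfl⟩)
  · exact Or.inr (Or.inr ⟨(β, α), ⟨he.2.2.1, (he.2.1.trans_le he.2.2.1).le⟩, rfl⟩)

theorem finite_outSteps (r : ℕ) (m : ℕ → ℤ) (u : Vertex) : (outSteps r m u).Finite :=
  (finite_valid r m).subset fun _ h => h.1

theorem outSteps_root : outSteps r m (.spine 0) = {Step.up 1} := by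
  ext e
  simp only [outSteps, Set.mem_ofPred_eq, Set.mem_singleton_iff]
  constructor
  · rintro ⟨hv, hs⟩
    rcases e with e | e | ⟨β, α⟩
    · rcases label_cases hv.1 hv.2 with rfl | ⟨γ, hγ, rfl | rfl⟩
      · rfl
      · rw [Step.source, nearEnd_even, Vertex.spine.injEq] at hs
        simp [base] at hs
      · rw [Step.source, nearEnd_odd, Vertex.spine.injEq] at hs
        omega
    · have := height_farEnd (m := m) hv.1 hv.2
      rw [Step.source] at hs
      rw [hs] at this
      simp [Vertex.height] at this
    · rw [Step.source, Vertex.spine.injEq] at hs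
      omega
  · rintro rfl
    exact ⟨⟨le_rfl, by omega⟩, rfl⟩

theorem outSteps_lower {β : ℕ} (hβ : β + 1 ≤ r) (h : β = 0 ∨ m (β + 1) = m β + 1) :
    outSteps r m (.spine (base m (β + 1))) = {Step.up (2 * (β + 1)), Step.down (2 * β + 1)} := by
  have hb1 : base m (β + 1) ≠ 0 := by simp [base]
  ext e
  simp only [outSteps, Set.mem_ofPred_eq, Set.mem_insert_iff, Set.mem_singleton_iff]
  constructor
  · rintro ⟨hv, hs⟩
    have hpred : ∀ γ, γ + 1 ≤ r → base m (γ + 1) + 1 ≠ base m (β + 1) := by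
      intro γ hγ hs
      rcases lt_trichotomy γ β with hlt | rfl | hlt
      · obtain ⟨β, rfl⟩ : ∃ δ, β = δ + 1 := ⟨β - 1, by omega⟩
        have := base_succ_of_ascent (m := m) (β := β) (by simpa using h)
        have := base_add_le (m := m) (show γ + 1 ≤ β + 1 by omega)
        simp only [Nat.add_assoc, Nat.reduceAdd] at *
        omega
      · omega
      · have := base_add_le (m := m) (show β + 1 ≤ γ + 1 by omega)
        omega
    rcases e with e | e | ⟨δ, α⟩
    · rcases label_cases hv.1 hv.2 with rfl | ⟨γ, hγ, rfl | rfl⟩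
      · rw [Step.source, nearEnd_one, Vertex.spine.injEq] at hs
        omega
      · rw [Step.source, nearEnd_even, Vertex.spine.injEq] at hs
        rcases lt_trichotomy γ β with hlt | rfl | hlt
        · have := base_add_le (m := m) (show γ + 1 ≤ β + 1 by omega)
          omega
        · exact Or.inl rfl
        · have := base_add_le (m := m) (show β + 1 ≤ γ + 1 by omega)
          omega
      · rw [Step.source, nearEnd_odd, Vertex.spine.injEq] at hs
        exact absurd hs (hpred γ hγ)
    · rcases label_cases hv.1 hv.2 with rfl | ⟨γ, hγ, rfl | rfl⟩
      · rw [Step.source, farEnd_one, Vertex.spine.injEq] at hs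
        rcases β with _ | β
        · exact Or.inr rfl
        · have := base_add_le (m := m) (show 1 ≤ β + 1 + 1 by omega)
          rw [base_one] at this
          omega
      · rw [Step.source, farEnd_even, Vertex.spine.injEq] at hs
        exact absurd hs (hpred γ hγ)
      · by_cases h' : γ + 1 = r ∨ m (γ + 2) = m (γ + 1) + 1
        · rw [Step.source, farEnd_odd_of_spine h', Vertex.spine.injEq] at hs
          rcases lt_trichotomy (γ + 1) β with hlt | rfl | hlt
          · have h1 := base_succ_of_ascent (m := m) (β := γ) (by rcases h' with h' | h'; omega; exact h')
            have := base_add_le (m := m) (show γ + 2 ≤ β + 1 by omega)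
            omega
          · exact Or.inr rfl
          · have := base_add_le (m := m) (show β + 1 ≤ γ + 1 by omega)
            omega
        · rw [Step.source, farEnd_odd_of_off h'] at hs
          exact absurd hs (by simp)
    · rw [Step.source, Vertex.spine.injEq] at hs
      obtain ⟨δ, rfl⟩ : ∃ γ, δ = γ + 1 := ⟨δ - 1, by have := hv.2.1; omega⟩
      exact absurd hs (hpred δ hv.2.2.1)
  · rintro (rfl | rfl)
    · exact ⟨⟨by omega, by omega⟩, nearEnd_even β⟩
    · refine ⟨⟨by omega, by omega⟩, ?_⟩
      rcases β with _ | β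
      · simp [Step.source, farEnd_one, base_one]
      · have h' : m (β + 2) = m (β + 1) + 1 := by simpa using h
        rw [Step.source, farEnd_odd_of_spine (Or.inr h'), base_succ_of_ascent h']

theorem outSteps_off {β : ℕ} (hβ : β + 1 ≤ r) (h : ¬ (β + 1 = r ∨ m (β + 2) = m (β + 1) + 1)) :
    outSteps r m (.off (base m (β + 1) + 1)) = {Step.down (2 * (β + 1) + 1)} := by
  ext e
  simp only [outSteps, Set.mem_ofPred_eq, Set.mem_singleton_iff]
  constructor
  · rintro ⟨hv, hs⟩
    rcases e with e | e | ⟨δ, α⟩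
    · rcases label_cases hv.1 hv.2 with rfl | ⟨γ, hγ, rfl | rfl⟩
      · simp [Step.source, nearEnd_one] at hs
      · simp [Step.source, nearEnd_even] at hs
      · simp [Step.source, nearEnd_odd] at hs
    · rcases label_cases hv.1 hv.2 with rfl | ⟨γ, hγ, rfl | rfl⟩
      · simp [Step.source, farEnd_one] at hs
      · simp [Step.source, farEnd_even] at hs
      · by_cases h' : γ + 1 = r ∨ m (γ + 2) = m (γ + 1) + 1
        · simp [Step.source, farEnd_odd_of_spine h'] at hs
        · rw [Step.source, farEnd_odd_of_off h', Vertex.off.injEq] at hs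
          rcases lt_trichotomy γ β with hlt | rfl | hlt
          · have := base_add_le (m := m) (show γ + 1 ≤ β + 1 by omega)
            omega
          · rfl
          · have := base_add_le (m := m) (show β + 1 ≤ γ + 1 by omega)
            omega
    · simp [Step.source] at hs
  · rintro rfl
    exact ⟨⟨by omega, by omega⟩, farEnd_odd_of_off h⟩

theorem outSteps_top {β : ℕ} (hβ : β + 1 = r) :
    outSteps r m (.spine (base m (β + 1) + 2)) = {Step.down (2 * (β + 1) + 1)} := by
  subst hβ
  have hle : ∀ γ, γ + 1 ≤ β + 1 → base m (γ + 1) ≤ base m (β + 1) := fun γ hγ => by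
    have := base_add_le (m := m) hγ
    omega
  ext e
  simp only [outSteps, Set.mem_ofPred_eq, Set.mem_singleton_iff]
  constructor
  · rintro ⟨hv, hs⟩
    rcases e with e | e | ⟨δ, α⟩
    · rcases label_cases hv.1 hv.2 with rfl | ⟨γ, hγ, rfl | rfl⟩
      · simp [Step.source, nearEnd_one] at hs
      · have := hle γ hγ
        rw [Step.source, nearEnd_even, Vertex.spine.injEq] at hs
        omega
      · have := hle γ hγ
        rw [Step.source, nearEnd_odd, Vertex.spine.injEq] at hs
        omega
    · rcases label_cases hv.1 hv.2 with rfl | ⟨γ, hγ, rfl | rfl⟩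
      · simp [Step.source, farEnd_one] at hs
      · have := hle γ hγ
        rw [Step.source, farEnd_even, Vertex.spine.injEq] at hs
        omega
      · by_cases h' : γ + 1 = β + 1 ∨ m (γ + 2) = m (γ + 1) + 1
        · rw [Step.source, farEnd_odd_of_spine h', Vertex.spine.injEq] at hs
          have := base_add_le (m := m) hγ
          obtain rfl : γ = β := by omega
          rfl
        · simp [Step.source, farEnd_odd_of_off h'] at hs
    · obtain ⟨δ, rfl⟩ : ∃ γ, δ = γ + 1 := ⟨δ - 1, by have := hv.2.1; omega⟩
      have := hle δ hv.2.2.1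
      rw [Step.source, Vertex.spine.injEq] at hs
      omega
  · rintro rfl
    exact ⟨⟨by omega, by omega⟩, farEnd_odd_of_spine (Or.inl rfl)⟩

/-- The bottoms of the long edges from the top of the skeleton edge `2β`. -/
def runBelow (m : ℕ → ℤ) (β : ℕ) : Set ℕ :=
  {α | 1 ≤ α ∧ α < β ∧ ∀ γ, α ≤ γ → γ < β → m (γ + 1) = m γ - 1}

theorem finite_runBelow (β : ℕ) : (runBelow m β).Finite :=
  (Set.finite_Iio β).subset fun _ h => h.2.1

theorem runBelow_succ_of_descent {β : ℕ} (h1 : 1 ≤ β) (h : m (β + 1) = m β - 1) :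
    runBelow m (β + 1) = insert β (runBelow m β) := by
  ext α
  simp only [runBelow, Set.mem_ofPred_eq, Set.mem_insert_iff]
  constructor
  · rintro ⟨a, b, c⟩
    by_cases hα : α = β
    · exact Or.inl hα
    · exact Or.inr ⟨a, by omega, fun γ h2 h3 => c γ h2 (by omega)⟩
  · rintro (rfl | ⟨a, b, c⟩)
    · exact ⟨h1, by omega, fun γ h2 h3 => by obtain rfl : γ = α := by omega
                                             exact h⟩
    · refine ⟨a, by omega, fun γ h2 h3 => ?_⟩
      rcases Nat.lt_or_ge γ β with h4 | h4
      · exact c γ h2 h4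
      · obtain rfl : γ = β := by omega
        exact h

theorem runBelow_succ_of_not_descent {β : ℕ} (h : ¬ (1 ≤ β ∧ m (β + 1) = m β - 1)) :
    runBelow m (β + 1) = ∅ := by
  ext α
  simp only [runBelow, Set.mem_ofPred_eq, Set.mem_empty_iff_false, iff_false]
  rintro ⟨a, b, c⟩
  exact h ⟨by omega, c β (by omega) (by omega)⟩

/-- The last set is the next even edge, which starts here exactly when no spine edge intervenes. -/
theorem outSteps_upper {β : ℕ} (hβ : β + 1 ≤ r) :
    outSteps r m (.spine (base m (β + 1) + 1)) =
      insert (Step.down (2 * (β + 1))) (insert (Step.up (2 * (β + 1) + 1))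
        (Step.long (β + 1) '' runBelow m (β + 1) ∪
          {e | e = Step.up (2 * (β + 2)) ∧ ¬ (β + 1 = r ∨ m (β + 2) = m (β + 1) + 1)})) := by
  have hinj : ∀ γ, base m (γ + 1) = base m (β + 1) → γ = β := by
    intro γ hs
    rcases lt_trichotomy γ β with hlt | rfl | hlt
    · have := base_add_le (m := m) (show γ + 1 ≤ β + 1 by omega)
      omega
    · rfl
    · have := base_add_le (m := m) (show β + 1 ≤ γ + 1 by omega)
      omega
  ext e
  simp only [outSteps, Set.mem_ofPred_eq, Set.mem_insert_iff, Set.mem_union, Set.mem_image]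
  constructor
  · rintro ⟨hv, hs⟩
    rcases e with e | e | ⟨δ, α⟩
    · rcases label_cases hv.1 hv.2 with rfl | ⟨γ, hγ, rfl | rfl⟩
      · simp [Step.source, nearEnd_one] at hs
      · rw [Step.source, nearEnd_even, Vertex.spine.injEq] at hs
        have hlt : β < γ := by
          by_contra hle
          have := base_add_le (m := m) (show γ + 1 ≤ β + 1 by omega)
          omega
        have := base_add_le (m := m) (show β + 2 ≤ γ + 1 by omega)
        have hn : m (β + 2) ≠ m (β + 1) + 1 := by
          intro hn
          have := base_succ_of_ascent hn
          omega
        have := base_succ_of_not_ascent hn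
        obtain rfl : γ = β + 1 := by omega
        refine Or.inr (Or.inr (Or.inr ⟨rfl, fun h => ?_⟩))
        rcases h with h | h
        · omega
        · exact hn h
      · rw [Step.source, nearEnd_odd, Vertex.spine.injEq] at hs
        obtain rfl := hinj γ (by omega)
        exact Or.inr (Or.inl rfl)
    · rcases label_cases hv.1 hv.2 with rfl | ⟨γ, hγ, rfl | rfl⟩
      · rw [Step.source, farEnd_one, Vertex.spine.injEq] at hs
        simp [base] at hs
      · rw [Step.source, farEnd_even, Vertex.spine.injEq] at hs
        obtain rfl := hinj γ (by omega)
        exact Or.inl rfl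
      · by_cases h' : γ + 1 = r ∨ m (γ + 2) = m (γ + 1) + 1
        · rw [Step.source, farEnd_odd_of_spine h', Vertex.spine.injEq] at hs
          have hlt : γ < β := by
            by_contra hle
            have := base_add_le (m := m) (show β + 1 ≤ γ + 1 by omega)
            omega
          have h1 := base_succ_of_ascent (m := m) (β := γ)
            (by rcases h' with h' | h'; omega; exact h')
          have := base_add_le (m := m) (show γ + 2 ≤ β + 1 by omega)
          omega
        · simp [Step.source, farEnd_odd_of_off h'] at hs
    · obtain ⟨δ, rfl⟩ : ∃ γ, δ = γ + 1 := ⟨δ - 1, by have := hv.2.1; omega⟩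
      rw [Step.source, Vertex.spine.injEq] at hs
      obtain rfl := hinj δ (by omega)
      exact Or.inr (Or.inr (Or.inl ⟨α, ⟨hv.1, hv.2.1, hv.2.2.2⟩, rfl⟩))
  · rintro (rfl | rfl | ⟨α, hα, rfl⟩ | ⟨rfl, h⟩)
    · exact ⟨⟨by omega, by omega⟩, farEnd_even β⟩
    · exact ⟨⟨by omega, by omega⟩, nearEnd_odd β⟩
    · exact ⟨⟨hα.1, hα.2.1, hβ, hα.2.2⟩, rfl⟩
    · have hn : m (β + 2) ≠ m (β + 1) + 1 := fun h' => h (Or.inr h')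
      refine ⟨⟨by omega, by omega⟩, ?_⟩
      rw [Step.source, nearEnd_even (β + 1), base_succ_of_not_ascent hn]

/-- The paths on `Γ_M` from `u` at time `t` to the root at time `t'`. -/
def pathsTo (r : ℕ) (m : ℕ → ℤ) (t' : ℤ) (u : Vertex) (t : ℤ) : Set (List Step) :=
  {p | IsPath r m (.spine 0) t' p u t}

/-- The difference of the two sides is twice the number of descending steps. -/
theorem IsPath.le {t' : ℤ} {p : List Step} {u : Vertex} {t : ℤ}
    (h : IsPath r m (.spine 0) t' p u t) : t ≤ t' + u.height := by
  induction p generalizing u t with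
  | nil =>
    obtain ⟨rfl, rfl⟩ := h
    simp [Vertex.height]
  | cons e p ih =>
    obtain ⟨hv, rfl, hp⟩ := h
    have h1 := ih hp
    have h2 := hv.height_target
    have h3 : 0 ≤ e.drop := by rcases e with _ | _ | _ <;> simp [Step.drop]
    omega

theorem pathsTo_eq_union (t' : ℤ) (u : Vertex) (t : ℤ) :
    pathsTo r m t' u t = {p | p = [] ∧ u = .spine 0 ∧ t = t'} ∪
      ⋃ e ∈ outSteps r m u, List.cons e '' pathsTo r m t' (e.target r m) (t + e.duration) := by
  ext p
  simp only [pathsTo, outSteps, Set.mem_ofPred_eq, Set.mem_union, Set.mem_iUnion, Set.mem_image,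
    exists_prop]
  rcases p with _ | ⟨e, p⟩
  · simp [IsPath]
  · simp only [IsPath, reduceCtorEq, false_and, false_or]
    constructor
    · rintro ⟨h1, h2, h3⟩
      exact ⟨e, ⟨h1, h2⟩, p, h3, rfl⟩
    · rintro ⟨e', ⟨h1, h2⟩, p', h3, h4⟩
      obtain ⟨rfl, rfl⟩ := List.cons.inj h4
      exact ⟨h1, h2, h3⟩

theorem finite_pathsTo (t' : ℤ) {u : Vertex} (hu : u.height ≤ base m r + 2) (t : ℤ) :
    (pathsTo r m t' u t).Finite := by
  obtain ⟨H, hH⟩ : ∃ H, H = base m r + 2 := ⟨_, rfl⟩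
  -- Long steps may go back in time, so time alone is no measure. A step up keeps the first summand
  -- and lowers the second by one; a descending step lowers the first by `2 * (H + 2)`, more than
  -- the second, at most `H`, can gain.
  suffices h : ∀ N : ℕ, ∀ u t, u.height ≤ H →
      (t' + u.height - t) * (H + 2) + (H - u.height) < N → (pathsTo r m t' u t).Finite from
    h (((t' + u.height - t) * (H + 2) + (H - u.height)).toNat + 1) u t (hH ▸ hu) (by omega)
  intro N
  induction N with
  | zero =>
    intro u t hu h
    have : pathsTo r m t' u t = ∅ := by
      refine Set.eq_empty_of_forall_notMem fun p hp => ?_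
      have h1 := IsPath.le hp
      have : 0 ≤ (t' + u.height - t) * (H + 2) := mul_nonneg (by omega) (by omega)
      push_cast at h
      omega
    rw [this]
    exact Set.finite_empty
  | succ N ih =>
    intro u t hu h
    rw [pathsTo_eq_union]
    refine ((Set.finite_singleton []).subset fun p hp => hp.1).union
      ((finite_outSteps r m u).biUnion fun e he => (ih _ _ ?_ ?_).image _)
    · rw [hH]
      exact he.1.height_target_le
    · obtain ⟨hv, rfl⟩ := he
      have h1 := hv.height_target
      have h2 : t' + (e.target r m).height - (t + e.duration) =
        t' + (e.source r m).height - t - 2 * e.drop := by omega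
      have h4 : (e.target r m).height ≤ H := hH ▸ hv.height_target_le
      rw [h2, sub_mul]
      push_cast at h
      rcases e with e | e | ⟨β, α⟩ <;> simp only [Step.drop, Step.duration] at h1 h2 ⊢ <;> omega

end Graph

/-! ### Splitting partition functions by the first step. -/

section PathSum

variable {K : Type*} [Field K] {r : ℕ} {m : ℕ → ℤ} {T : ℕ → ℤ → ℤ → K}

/-- The partition function of the paths from `u` at time `t` to the root at time `t'`. -/
noncomputable def pathSum (r : ℕ) (m : ℕ → ℤ) (T : ℕ → ℤ → ℤ → K) (t' : ℤ) (u : Vertex) (t : ℤ) :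
    K :=
  ∑ᶠ p ∈ pathsTo r m t' u t, pathWeight m T p t

theorem pathSum_eq_zero {t' : ℤ} {u : Vertex} {t : ℤ} (h : t' + u.height < t) :
    pathSum r m T t' u t = 0 := by
  have : pathsTo r m t' u t = ∅ :=
    Set.eq_empty_of_forall_notMem fun p hp => absurd (IsPath.le hp) (by omega)
  rw [pathSum, this, finsum_mem_empty]

open Classical in
theorem pathSum_eq (t' : ℤ) (u : Vertex) (t : ℤ) :
    pathSum r m T t' u t = (if u = .spine 0 ∧ t = t' then 1 else 0) +
      ∑ᶠ e ∈ outSteps r m u,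
        e.weight m T t * pathSum r m T t' (e.target r m) (t + e.duration) := by
  have hfin : ∀ e ∈ outSteps r m u,
      (pathsTo r m t' (e.target r m) (t + e.duration)).Finite := fun e he =>
    finite_pathsTo t' he.1.height_target_le _
  rw [pathSum, pathsTo_eq_union, finsum_mem_union, finsum_mem_biUnion _ (finite_outSteps r m u)]
  · congr 1
    · split_ifs with h
      · have : {p : List Step | p = [] ∧ u = .spine 0 ∧ t = t'} = {[]} := by
          ext p; simp [h]
        rw [this, finsum_mem_singleton, pathWeight]
      · have : {p : List Step | p = [] ∧ u = .spine 0 ∧ t = t'} = ∅ := by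
          ext p; simp only [Set.mem_ofPred_eq, Set.mem_empty_iff_false, iff_false]; tauto
        rw [this, finsum_mem_empty]
    · refine finsum_mem_congr rfl fun e he => ?_
      rw [finsum_mem_image (List.cons_injective.injOn), pathSum, mul_finsum_mem]
      rfl
  · exact fun e he => (hfin e he).image _
  · intro e he e' he' hne
    refine Set.disjoint_left.2 ?_
    rintro _ ⟨p, _, rfl⟩ ⟨p', _, h⟩
    exact hne (List.cons.inj h).1.symm
  · refine Set.disjoint_left.2 ?_
    rintro p ⟨rfl, _⟩ hp
    simp at hp
  · exact (Set.finite_singleton []).subset fun p hp => hp.1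
  · exact (finite_outSteps r m u).biUnion fun e he => (hfin e he).image _

end PathSum

/-! ### The path sums solve the recursion. -/

section PathSystem

variable {K : Type*} [Field K] {r : ℕ} {m : ℕ → ℤ} {T : ℕ → ℤ → ℤ → K}

/-- The partition functions of the paths to the root, from the root and from the tops of the
skeleton edges `2β`, with `n` descending steps. -/
noncomputable def pathValue (r : ℕ) (m : ℕ → ℤ) (T : ℕ → ℤ → ℤ → K) (t' : ℤ) : ℕ → ℤ → K
  | 0, n => pathSum r m T t' (.spine 0) (t' - 2 * n)
  | β + 1, n => pathSum r m T t' (.spine (base m (β + 1) + 1)) (tick m t' (β + 1) n)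

theorem tick_one (t' n : ℤ) : tick m t' 1 n = t' - 2 * n + 2 := by
  rw [tick, show ascents m 1 = 0 from rfl]
  push_cast
  ring

theorem tick_sub_one (t' : ℤ) (β : ℕ) (n : ℤ) : tick m t' β (n - 1) = tick m t' β n + 2 := by
  rw [tick, tick]
  ring

theorem tick_succ_of_ascent (t' : ℤ) {β : ℕ} (h : m (β + 2) = m (β + 1) + 1) (n : ℤ) :
    tick m t' (β + 2) n = tick m t' (β + 1) n + 2 := by
  rw [tick, tick, ascents_succ, if_pos ⟨by omega, h⟩]
  push_cast
  ring

theorem tick_succ_of_not_ascent (t' : ℤ) {β : ℕ} (h : m (β + 2) ≠ m (β + 1) + 1) (n : ℤ) :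
    tick m t' (β + 2) n = tick m t' (β + 1) n + 1 := by
  rw [tick, tick, ascents_succ, if_neg fun h' => h h'.2]
  push_cast
  ring

/-- Eliminates the bottom of an even edge: either it has only two exits, or it is itself the top of
the previous even edge. -/
theorem pathSum_lower {β : ℕ} (hβ : β + 1 ≤ r) (t' n : ℤ) :
    pathSum r m T t' (.spine (base m (β + 1))) (tick m t' (β + 1) n - 1) =
      lowerValue m (skeletonWeight m T) t' (pathValue r m T t') β n := by
  rw [lowerValue]
  split_ifs with h
  · rw [pathSum_eq, outSteps_lower hβ h,
      finsum_mem_pair (by simp), if_neg, zero_add, add_comm]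
    · simp only [Step.weight, Step.target, Step.duration, one_mul, sub_add_cancel, farEnd_even]
      congr 2
      rcases β with _ | β
      · simp only [pathValue]
        rw [Nat.mul_zero, zero_add, nearEnd_one, tick_one]
        congr 1
        ring
      · rw [nearEnd_odd, tick_succ_of_ascent t' (by simpa using h), pathValue, tick_sub_one]
    · simp [base]
  · obtain ⟨β, rfl⟩ : ∃ γ, β = γ + 1 := ⟨β - 1, by omega⟩
    have h' : m (β + 2) ≠ m (β + 1) + 1 := fun h' => h (Or.inr h')
    rw [pathValue, base_succ_of_not_ascent h', tick_succ_of_not_ascent t' h', add_sub_cancel_right]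

theorem longWeight_succ {β α : ℕ} (h : α < β) (t : ℤ) :
    (Step.long (β + 1) α).weight m T t =
      skeletonWeight m T (2 * (β + 1)) t / skeletonWeight m T (2 * β + 1) t *
        (Step.long β α).weight m T (t - 1) := by
  simp only [Step.weight]
  rw [show β + 1 - α = β - α + 1 by omega, Finset.prod_range_succ', mul_comm (∏ _ ∈ _, _), mul_assoc]
  congr 1
  · simp only [Nat.cast_zero, sub_zero, Nat.sub_zero]
    rfl
  · congr 1
    · refine Finset.prod_congr rfl fun i _ => ?_
      rw [Nat.add_sub_add_right]
      congr 2 <;> push_cast <;> ring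
    · congr 1
      push_cast
      ring

theorem longWeight_self_succ (β : ℕ) (t : ℤ) :
    (Step.long (β + 1) β).weight m T t =
      skeletonWeight m T (2 * (β + 1)) t / skeletonWeight m T (2 * β + 1) t *
        skeletonWeight m T (2 * β) (t - 1) := by
  simp only [Step.weight]
  rw [show β + 1 - β = 0 + 1 by omega, Finset.prod_range_one]
  simp only [Nat.cast_zero, sub_zero, Nat.sub_zero]
  congr 2
  push_cast
  ring

/-- Long edges from consecutive tops of a run differ by the first factor of the weight, so unrolling
the recursion yields the short step and all long edges. -/
theorem descentSum_eq_long (t' : ℤ) (b : ℕ → ℤ → K) (β : ℕ) (n : ℤ) :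
    descentSum m (skeletonWeight m T) t' b (β + 1) n =
      skeletonWeight m T (2 * (β + 1)) (tick m t' (β + 1) n) *
        lowerValue m (skeletonWeight m T) t' b β (n - 1) +
      ∑ᶠ α ∈ runBelow m (β + 1), (Step.long (β + 1) α).weight m T (tick m t' (β + 1) n) *
        lowerValue m (skeletonWeight m T) t' b (α - 1) (n - 1) := by
  induction β with
  | zero =>
    rw [runBelow_succ_of_not_descent (by omega), finsum_mem_empty, descentSum, if_neg (by omega)]
  | succ β ih =>
    rw [descentSum]
    congr 1
    split_ifs with h
    · have hd : m (β + 2) = m (β + 1) - 1 := h.2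
      have ht : tick m t' (β + 2) n = tick m t' (β + 1) n + 1 :=
        tick_succ_of_not_ascent t' (by omega) n
      rw [runBelow_succ_of_descent h.1 h.2, finsum_mem_insert _ (fun h => lt_irrefl _ h.2.1)
        (finite_runBelow _), ih, mul_add, longWeight_self_succ, mul_finsum_mem, ht,
        add_sub_cancel_right, mul_assoc]
      congr 1
      refine finsum_mem_congr rfl fun α hα => ?_
      rw [longWeight_succ hα.2.1, add_sub_cancel_right, mul_assoc]
    · rw [runBelow_succ_of_not_descent h, finsum_mem_empty]

/-- Eliminates the far end of an odd edge: a dead end at an off-spine vertex or at the top of the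
graph, otherwise the bottom of the next even edge. -/
theorem pathSum_off {β : ℕ} (hβ : β + 1 ≤ r) (t' n : ℤ) :
    pathSum r m T t' (farEnd r m (2 * (β + 1) + 1)) (tick m t' (β + 1) n + 1) =
      skeletonWeight m T (2 * (β + 1) + 1) (tick m t' (β + 1) n + 1) *
        pathValue r m T t' (β + 1) (n - 1) +
      if β + 1 ≠ r ∧ m (β + 2) = m (β + 1) + 1 then pathValue r m T t' (β + 2) n else 0 := by
  by_cases h : β + 1 ≠ r ∧ m (β + 2) = m (β + 1) + 1
  · have low := pathSum_lower (T := T) (r := r) (m := m) (β := β + 1) (by omega) t' n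
    rw [lowerValue, if_pos (Or.inr h.2), tick_succ_of_ascent t' h.2, base_succ_of_ascent h.2] at low
    rw [if_pos h, farEnd_odd_of_spine (Or.inr h.2),
      show tick m t' (β + 1) n + 1 = tick m t' (β + 1) n + 2 - 1 by ring, low]
  · rw [if_neg h, add_zero]
    have key : ∀ u : Vertex, u.height = base m (β + 1) + 2 →
        outSteps r m u = {Step.down (2 * (β + 1) + 1)} →
        pathSum r m T t' u (tick m t' (β + 1) n + 1) =
          skeletonWeight m T (2 * (β + 1) + 1) (tick m t' (β + 1) n + 1) *
            pathValue r m T t' (β + 1) (n - 1) := by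
      intro u hu hout
      rw [pathSum_eq, hout, finsum_mem_singleton, if_neg, zero_add]
      · simp only [Step.weight, Step.target, Step.duration]
        rw [nearEnd_odd, pathValue, tick_sub_one]
        congr 2
        ring
      · rintro ⟨rfl, -⟩
        simp [Vertex.height] at hu
    by_cases h1 : β + 1 = r
    · rw [farEnd_odd_of_spine (Or.inl h1)]
      exact key _ rfl (outSteps_top h1)
    · have h2 : ¬ (β + 1 = r ∨ m (β + 2) = m (β + 1) + 1) := by tauto
      rw [farEnd_odd_of_off h2]
      exact key _ rfl (outSteps_off hβ h2)

theorem reducedSystem_pathValue (hr : 1 ≤ r) (t' : ℤ) :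
    ReducedSystem r m (skeletonWeight m T) t' (pathValue r m T t') where
  neg β hβ n hn := by
    rcases β with _ | β
    · rw [pathValue, pathSum_eq_zero]
      simp only [Vertex.height]
      push_cast
      omega
    · rw [pathValue, pathSum_eq_zero]
      simp only [Vertex.height, tick, base]
      push_cast
      omega
  root n := by
    have low := pathSum_lower (T := T) (m := m) hr t' n
    rw [lowerValue, if_pos (Or.inl rfl), tick_one, base_one,
      show t' - 2 * n + 2 - 1 = t' - 2 * n + 1 by ring] at low
    conv_lhs => rw [pathValue]
    rw [pathSum_eq, outSteps_root, finsum_mem_singleton, add_assoc]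
    congr 1
    · simp
    · simp only [Step.weight, Step.target, Step.duration, one_mul, farEnd_one]
      rw [low, Nat.mul_zero, zero_add, show t' + 1 - 2 * n = t' - 2 * n + 1 by ring]
  spine β hβ n := by
    have hup : {e | e = Step.up (2 * (β + 2)) ∧ ¬ (β + 1 = r ∨ m (β + 2) = m (β + 1) + 1)}.Finite :=
      (Set.finite_singleton (Step.up (2 * (β + 2)))).subset fun e he => he.1
    have hlong := (finite_runBelow (m := m) (β + 1)).image (Step.long (β + 1))
    conv_lhs => rw [pathValue]
    rw [pathSum_eq, outSteps_upper hβ, if_neg (by simp),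
      zero_add, finsum_mem_insert _ (by simp) ((hlong.union hup).insert _),
      finsum_mem_insert _ (by simp; omega) (hlong.union hup), finsum_mem_union _ hlong hup,
      finsum_mem_image fun a _ b _ h => (Step.long.inj h).2, descentSum_eq_long]
    -- Direct passage to the next top, when there is no ascent; with an ascent the same term comes
    -- from `pathSum_off`.
    · have hup' : (∑ᶠ e ∈ {e | e = Step.up (2 * (β + 2)) ∧
            ¬ (β + 1 = r ∨ m (β + 2) = m (β + 1) + 1)}, e.weight m T (tick m t' (β + 1) n) *
              pathSum r m T t' (e.target r m) (tick m t' (β + 1) n + e.duration)) =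
          if β + 1 ≠ r ∧ m (β + 2) ≠ m (β + 1) + 1 then pathValue r m T t' (β + 2) n else 0 := by
        split_ifs with h
        · have : {e | e = Step.up (2 * (β + 2)) ∧
              ¬ (β + 1 = r ∨ m (β + 2) = m (β + 1) + 1)} = {Step.up (2 * (β + 2))} := by
            ext e; simp only [Set.mem_ofPred_eq, Set.mem_singleton_iff]; tauto
          rw [this, finsum_mem_singleton]
          simp only [Step.weight, Step.target, Step.duration, one_mul]
          rw [farEnd_even (β + 1), pathValue, tick_succ_of_not_ascent t' h.2]
        · have : {e | e = Step.up (2 * (β + 2)) ∧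
              ¬ (β + 1 = r ∨ m (β + 2) = m (β + 1) + 1)} = ∅ := by
            ext e; simp only [Set.mem_ofPred_eq, Set.mem_empty_iff_false, iff_false]; tauto
          rw [this, finsum_mem_empty]
      have hlow : pathSum r m T t' (.spine (base m (β + 1))) (tick m t' (β + 1) n + 1) =
          lowerValue m (skeletonWeight m T) t' (pathValue r m T t') β (n - 1) := by
        rw [← pathSum_lower hβ, tick_sub_one]
        congr 1
        ring
      have hrun : (∑ᶠ α ∈ runBelow m (β + 1), (Step.long (β + 1) α).weight m T
            (tick m t' (β + 1) n) * pathSum r m T t' ((Step.long (β + 1) α).target r m)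
              (tick m t' (β + 1) n + (Step.long (β + 1) α).duration)) =
          ∑ᶠ α ∈ runBelow m (β + 1), (Step.long (β + 1) α).weight m T (tick m t' (β + 1) n) *
            lowerValue m (skeletonWeight m T) t' (pathValue r m T t') (α - 1) (n - 1) := by
        refine finsum_mem_congr rfl fun α hα => ?_
        obtain ⟨α, rfl⟩ : ∃ γ, α = γ + 1 := ⟨α - 1, by have := hα.1; omega⟩
        rw [Nat.add_sub_cancel, ← pathSum_lower (by have := hα.2.1; omega), Step.target,
          Step.duration, tick, tick, ascents_eq_of_run hα.2.1.le hα.2.2]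
        congr 2
        push_cast
        ring
      rw [hup', hrun]
      simp only [Step.weight, Step.target, Step.duration, one_mul]
      rw [nearEnd_even, hlow, pathSum_off hβ]
      by_cases h1 : β + 1 = r
      · rw [if_neg (by tauto), if_neg (by tauto), if_neg (by omega)]
        ring
      · by_cases h2 : m (β + 2) = m (β + 1) + 1
        · rw [if_pos ⟨h1, h2⟩, if_neg (by tauto), if_pos (by omega)]
          ring
        · rw [if_neg (by tauto), if_pos ⟨h1, h2⟩, if_pos (by omega)]
          ring
    · refine Set.disjoint_left.2 ?_
      rintro _ ⟨a, _, rfl⟩ ⟨h, _⟩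
      exact absurd h (by simp)

theorem partitionFunction_eq (hr : 1 ≤ r) (hm : IsMotzkin r m) (hT : IsSolution r T) (j : ℤ)
    (k : ℕ) :
    partitionFunction r m T (j - k) (j + k) = T 1 j (k + m 1) / T 1 (j + k) (m 1) := by
  have h := (reducedSystem_pathValue (m := m) (T := T) hr (j + k)).unique hr
    (reducedSystem_seedValue hr hT hm (j + k)) 0 (by omega) k
  have h0 : extPath m 0 = m 1 - 1 := rfl
  rw [pathValue, seedValue_of_le hT (by omega) (by omega), seedWave, nwave, hT.bot, div_one, wave,
    bottomRow, h0] at h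
  rw [show j + (k : ℤ) - 2 * k = j - k by ring] at h
  rw [partitionFunction, rootPaths]
  refine h.trans ?_
  congr 2 <;> push_cast <;> omega

end PathSystem

/-! ### Path weights as Laurent monomials in the seed. -/

section Laurent

variable {r : ℕ} {m : ℕ → ℤ}

/-- A function of the solution of the T-system is a Laurent monomial in the seed data. -/
def IsSeedMonomial.{u} (r : ℕ) (m : ℕ → ℤ)
    (F : ∀ (K : Type u) [Field K], (ℕ → ℤ → ℤ → K) → K) : Prop :=
  ∃ e : SeedIndex r →₀ ℤ, ∀ (K : Type u) [Field K] (T : ℕ → ℤ → ℤ → K), IsSolution r T →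
    F K T = e.prod fun s n => seed r m T s ^ n

theorem IsSolution.seed_ne_zero {K : Type*} [Field K] {T : ℕ → ℤ → ℤ → K} (hT : IsSolution r T)
    (s : SeedIndex r) : seed r m T s ≠ 0 :=
  hT.ne_zero _ (by omega) (by omega) _ _

namespace IsSeedMonomial

universe u

variable {F G : ∀ (K : Type u) [Field K], (ℕ → ℤ → ℤ → K) → K}

theorem congr (hF : IsSeedMonomial r m F)
    (h : ∀ (K : Type u) [Field K] (T : ℕ → ℤ → ℤ → K), IsSolution r T → G K T = F K T) :
    IsSeedMonomial r m G := by
  obtain ⟨e, he⟩ := hF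
  exact ⟨e, fun K _ T hT => (h K T hT).trans (he K T hT)⟩

theorem one : IsSeedMonomial.{u} r m fun _ _ _ => 1 :=
  ⟨0, fun _ _ _ _ => Finsupp.prod_zero_index.symm⟩

theorem mul (hF : IsSeedMonomial r m F) (hG : IsSeedMonomial r m G) :
    IsSeedMonomial r m fun K _ T => F K T * G K T := by
  classical
  obtain ⟨e, he⟩ := hF
  obtain ⟨e', he'⟩ := hG
  refine ⟨e + e', fun K _ T hT => ?_⟩
  simp only [he K T hT, he' K T hT]
  rw [Finsupp.prod_add_index]
  · exact fun _ _ => zpow_zero _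
  · exact fun s _ a b => zpow_add₀ (hT.seed_ne_zero s) a b

theorem inv (hF : IsSeedMonomial r m F) : IsSeedMonomial r m fun K _ T => (F K T)⁻¹ := by
  obtain ⟨e, he⟩ := hF
  refine ⟨-e, fun K _ T hT => ?_⟩
  simp only [he K T hT]
  rw [Finsupp.prod_neg_index fun _ => zpow_zero _, Finsupp.prod, Finsupp.prod,
    ← Finset.prod_inv_distrib]
  exact Finset.prod_congr rfl fun s _ => (zpow_neg _ _).symm

theorem div (hF : IsSeedMonomial r m F) (hG : IsSeedMonomial r m G) :
    IsSeedMonomial r m fun K _ T => F K T / G K T :=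
  (hF.mul hG.inv).congr fun _ _ _ _ => div_eq_mul_inv _ _

theorem prod_range {f : ℕ → ∀ (K : Type u) [Field K], (ℕ → ℤ → ℤ → K) → K} (n : ℕ)
    (h : ∀ i < n, IsSeedMonomial r m (f i)) :
    IsSeedMonomial r m fun K _ T => ∏ i ∈ Finset.range n, f i K T := by
  induction n with
  | zero => exact one.congr fun _ _ _ _ => Finset.prod_range_zero _
  | succ n ih =>
    exact ((ih fun i hi => h i (by omega)).mul (h n (by omega))).congr fun _ _ _ _ =>
      Finset.prod_range_succ _ _

theorem variable_mem {α : ℕ} (hα : α ≤ r + 1) (j : ℤ) {k : ℤ}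
    (hk : 1 ≤ α → α ≤ r → k = m α ∨ k = m α + 1) :
    IsSeedMonomial.{u} r m fun _ _ T => T α j k := by
  rcases Nat.eq_zero_or_pos α with rfl | h
  · exact one.congr fun K _ T hT => hT.bot j k
  · rcases Nat.lt_or_ge r α with h' | h'
    · obtain rfl : α = r + 1 := by omega
      exact one.congr fun K _ T hT => hT.top j k
    · obtain ⟨i, hi⟩ : ∃ i : Fin 2, k = m α + (i.val : ℤ) := by
        rcases hk h h' with rfl | rfl
        · exact ⟨0, by simp⟩
        · exact ⟨1, by simp⟩
      refine ⟨Finsupp.single (⟨α - 1, by omega⟩, j, i) 1, fun K _ T hT => ?_⟩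
      rw [Finsupp.prod_single_index (zpow_zero _), zpow_one, seed]
      simp only [show α - 1 + 1 = α by omega, hi]

theorem lam_mem {α : ℕ} (hα : α ≤ r + 1) (j : ℤ) :
    IsSeedMonomial.{u} r m fun _ _ T => lam T α j (m α) :=
  (variable_mem hα j fun _ _ => Or.inr rfl).div (variable_mem hα (j + 1) fun _ _ => Or.inl rfl)

/-- Odd weights are quotients of seed values of `lam`. In even weights the two `mu` contribute one
variable on each adjacent level, and this may lie outside the seed only if the step on that side is
a descent; then `A` or `B` exchanges it for a seed variable. -/
theorem skeletonWeight_mem (hm : IsMotzkin r m) {e : ℕ} (h1 : 1 ≤ e) (h2 : e ≤ 2 * r + 1) (t : ℤ) :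
    IsSeedMonomial.{u} r m fun _ _ T => skeletonWeight m T e t := by
  rcases label_cases h1 h2 with rfl | ⟨γ, hγ, rfl | rfl⟩
  · exact (lam_mem (α := 1) (by omega) t).congr fun K _ T _ => skeletonWeight_one t
  · have v1 := variable_mem.{u} (r := r) (m := m) (α := γ + 1) (by omega)
    obtain ⟨j, hj⟩ : ∃ j, j = t - ascents m (γ + 1) + m (γ + 1) - m 1 := ⟨_, rfl⟩
    have up : IsSeedMonomial.{u} r m fun _ _ T => T (γ + 2) j (m (γ + 1) + 1) *
        if m (γ + 1) = m (γ + 2) + 1 then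
          lam T (γ + 2) (t - ascents m (γ + 1) + m (γ + 2) - m 1) (m (γ + 2)) /
            lam T (γ + 2) j (m (γ + 1)) else 1 := by
      by_cases h : m (γ + 1) = m (γ + 2) + 1
      · refine ((variable_mem (α := γ + 2) (by omega) (j + 1) fun _ _ => Or.inr h).mul
          (lam_mem (α := γ + 2) (by omega)
            (t - ascents m (γ + 1) + m (γ + 2) - m 1))).congr fun K _ T hT => ?_
        have n1 := hT.ne_zero' (α := γ + 2) (by omega) j (m (γ + 1) + 1)
        have n2 := hT.ne_zero' (α := γ + 2) (by omega) (j + 1) (m (γ + 1))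
        rw [if_pos h, lam, lam]
        field_simp
      · refine (variable_mem (α := γ + 2) (by omega) j fun _ h' => ?_).congr fun K _ T hT => by
          rw [if_neg h, mul_one]
        have := abs_le.1 (hm (γ + 1) (by omega) (by omega))
        simp only [Nat.add_assoc, Nat.reduceAdd] at this
        omega
    have down : IsSeedMonomial.{u} r m fun _ _ T => T γ (j + 1) (m (γ + 1)) *
        if m (γ + 1) = m γ - 1 then
          lam T γ j (m (γ + 1)) / lam T γ (t - ascents m (γ + 1) + m γ - m 1) (m γ) else 1 := by
      by_cases h : m (γ + 1) = m γ - 1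
      · refine ((variable_mem (α := γ) (by omega) j fun _ _ => Or.inl (by omega)).div
          (lam_mem (α := γ) (by omega)
            (t - ascents m (γ + 1) + m γ - m 1))).congr (F := fun _ _ T =>
              T γ j (m (γ + 1) + 1) / lam T γ (t - ascents m (γ + 1) + m γ - m 1) (m γ))
              fun K _ T hT => ?_
        have n2 := hT.ne_zero' (α := γ) (by omega) (j + 1) (m (γ + 1))
        rw [if_pos h, lam]
        field_simp
      · refine (variable_mem (α := γ) (by omega) (j + 1) fun h' _ => ?_).congr fun K _ T hT => by
          rw [if_neg h, mul_one]
        have := abs_le.1 (hm γ h' (by omega))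
        omega
    refine ((up.mul down).div ((v1 (j + 1) fun _ _ => Or.inr rfl).mul
      (v1 j fun _ _ => Or.inl rfl))).congr fun K _ T hT => ?_
    rw [skeletonWeight_even, evenBase, mu, mu, ← hj]
    simp only [Nat.add_assoc, Nat.reduceAdd, show γ + 2 - 1 = γ + 1 by omega, Nat.add_sub_cancel]
    have n1 := hT.ne_zero' (α := γ + 1) (by omega) j (m (γ + 1))
    have n2 := hT.ne_zero' (α := γ) (by omega) (j + 1) (m (γ + 1))
    field_simp
  · exact ((lam_mem (α := γ + 2) (by omega) _).div (lam_mem (α := γ + 1) (by omega) _)).congr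
      fun K _ T _ => skeletonWeight_odd γ t

theorem stepWeight_mem (hm : IsMotzkin r m) {e : Step} (he : e.Valid r m) (t : ℤ) :
    IsSeedMonomial.{u} r m fun _ _ T => e.weight m T t := by
  rcases e with e | e | ⟨β, α⟩
  · exact one
  · exact skeletonWeight_mem hm he.1 he.2 t
  · obtain ⟨h1, h2, h3, -⟩ := he
    exact (prod_range (β - α) fun i hi => (skeletonWeight_mem hm (by omega) (by omega) _).div
      (skeletonWeight_mem hm (by omega) (by omega) _)).mul
        (skeletonWeight_mem hm (by omega) (by omega) _)

theorem pathWeight_mem (hm : IsMotzkin r m) {v u : Vertex} {t' t : ℤ} {p : List Step}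
    (hp : IsPath r m v t' p u t) : IsSeedMonomial.{u} r m fun _ _ T => pathWeight m T p t := by
  induction p generalizing u t with
  | nil => exact one
  | cons e p ih => exact (stepWeight_mem hm hp.1 t).mul (ih hp.2.2)

end IsSeedMonomial

theorem PosLaurent.eval_sum_single {σ ι K : Type*} [Field K] (s : Finset ι) (e : ι → σ →₀ ℤ)
    (x : σ → K) : PosLaurent.eval (∑ i ∈ s, Finsupp.single (e i) 1) x =
      ∑ i ∈ s, (e i).prod fun a n => x a ^ n := by
  classical
  rw [PosLaurent.eval, ← Finsupp.sum_finsetSum_index]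
  · exact Finset.sum_congr rfl fun i _ => by rw [Finsupp.sum_single_index] <;> simp
  · simp
  · intro a b c
    push_cast
    ring

end Laurent

end TSystem

theorem mainTheorem4 (r : ℕ) (hr : 1 ≤ r) (m : ℕ → ℤ) (hm : TSystem.IsMotzkin r m)
    (j : ℤ) (k : ℕ) :
    (TSystem.rootPaths r m (j - k) (j + k)).Finite ∧
    (∀ (K : Type*) [Field K] (T : ℕ → ℤ → ℤ → K), TSystem.IsSolution r T →
      T 1 j (k + m 1) / T 1 (j + k) (m 1) =
        TSystem.partitionFunction r m T (j - k) (j + k)) ∧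
    (∃ L : TSystem.PosLaurent (TSystem.SeedIndex r),
      ∀ (K : Type*) [Field K] (T : ℕ → ℤ → ℤ → K), TSystem.IsSolution r T →
        T 1 j (k + m 1) / T 1 (j + k) (m 1) = L.eval (TSystem.seed r m T)) := by
  have hfin : (TSystem.rootPaths r m (j - k) (j + k)).Finite :=
    TSystem.finite_pathsTo (j + k) (u := .spine 0) (Nat.zero_le _) (j - k)
  refine ⟨hfin, fun K _ T hT => (TSystem.partitionFunction_eq hr hm hT j k).symm, ?_⟩
  choose! e he using fun p (hp : p ∈ TSystem.rootPaths r m (j - k) (j + k)) =>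
    TSystem.IsSeedMonomial.pathWeight_mem hm hp
  -- One monomial per path, with exponents chosen before the field and the solution; coincident
  -- monomials add up to integer coefficients.
  refine ⟨∑ p ∈ hfin.toFinset, Finsupp.single (e p) 1, fun K _ T hT => ?_⟩
  rw [TSystem.PosLaurent.eval_sum_single, ← TSystem.partitionFunction_eq hr hm hT j k,
    TSystem.partitionFunction, finsum_mem_eq_finite_toFinset_sum _ hfin]
  exact Finset.sum_congr rfl fun p hp => he p (hfin.mem_toFinset.1 hp) K T hT
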